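/- Let $d\ge 1$ and, for an integer $\alpha\ge1$, let $\mathcal H_\alpha$ be the class of functions $\mathcal M:\mathbb R^d\to\mathbb R$ having weak partial derivatives $\mathcal D^{(i)}\mathcal M$ for all multi-indices $i\in\mathbb N^d$ with $i_1+\dots+i_d\le \alpha-1$ and satisfying, for some constant $M_\alpha>0$ and all $x,y\in\mathbb R^d$, $$\Big|\mathcal M(x)-\sum_{0\le i_1+\dots+i_d\le\alpha-1}\frac{\mathcal D^{(i)}\mathcal M(y)}{i_1!\cdots i_d!}\prod_{k=1}^d(x_k-y_k)^{i_k}\Big|\le M_\alpha\|x-y\|^\alpha ,$$ where $\|\cdot\|$ is the Euclidean norm. Let $\mathcal M\in\mathcal H_{d+1}$. Let $V_i=(V_{i,1},\dots,V_{i,d})$, $i\ge 1$, be i.i.d. random vectors with independent components such that $\mathbb E[V_{1,k}]=0$, $\mathbb E[V_{1,k}^2]=\sigma^2$ with $\sigma>0$, and $\mathbb E[V_{1,k}^{2q+1}]=0$, $\mathbb E[V_{1,k}^{2q}]<\infty$ for all $q\ge1$ and $k$. Let $L=5$ and let $\beta_1,\dots,\beta_5\in\mathbb R$ and, for every $p\in\{1,\dots,d\}$,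 $C^{(p)}_1,\dots,C^{(p)}_5\in\mathbb R$ be such that, with $r^*_p=\min(p-1,3)$, $$\sum_{\ell=1}^{5}C_\ell^{(p)}\beta_\ell^{\,r}=\delta_{p,r}\qquad\text{for all } r\in\{0,1,\dots,r^*_p\}\cup\{p\}.$$ For each $N$ let $h_N=(h_{N,1},\dots,h_{N,d})\in(0,\infty)^d$ be such that $\max_\ell|\beta_\ell|\,h_{N,j}\,\sigma\le 1/2$ for all $j$ (or, alternatively, $\max_\ell|\beta_\ell|\,h_{N,j}\,|V_{1,j}|\le 1$ almost surely for all $j$). Assume that $h_N\to0$ and $$\frac{\|h_N\|^{2(r^*_{|u|}+1)}}{N\prod_{k\in u}h_{N,k}^2}\longrightarrow 0\quad (N\to\infty)\qquad\text{for every non-empty } u\subseteq\{1,\dots,d\}$$ (for equal bandwidths $h_{N,k}=\mathsf h_N$ the latter is automatic if $d\le4$, and means $N\mathsf h_N^{2(d-4)}\to\infty$ if $d\geq 5$). For $y\in\mathbb R^d$ and non-empty $v\subseteq\{1,\dots,d\}$ put $$\widehat{\mathcal D^{|v|}\mathcal M}_N(y)=\frac1N\sum_{i=1}^N\sum_{\ell=1}^{5}C_\ell^{(|v|)}\,\mathcal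 M\big(y_1+\beta_\ell h_{N,1}V_{i,1},\dots,y_d+\beta_\ell h_{N,d}V_{i,d}\big)\prod_{k\in v}\frac{V_{i,k}}{h_{N,k}\,\sigma^2}.$$ Let $\Omega\subseteq\mathbb R^d$ be open and connected and let $X'=(X'_1,\dots,X'_d)$ be a random vector of independent variables supported on $\Omega$, with distribution functions $G_k$ and densities $g_k$ (that is, $X'\in\Omega$ almost surely and $g_k(y_k)>0$ for all $y\in\Omega$ and all $k$), such that $\mathbb E\|X'\|^{d+1}<\infty$. Then for every $x\in\Omega$ all expectations in the following formula exist, and $$\widehat{\mathcal M}_N(x):=\mathbb E[\mathcal M(X')]+\sum_{\substack{v\subseteq\{1,\dots,d\}\\|v|>0}}\mathbb E_{X'}\Big[\widehat{\mathcal D^{|v|}\mathcal M}_N(X')\prod_{k\in v}\frac{G_k(X'_k)-\mathbf 1_{[X'_k\ge x_k]}}{g_k(X'_k)}\Big]\ \xrightarrow{\;P\;}\ \mathcal M(x)\qquad(N\to\infty),$$ where $\mathbb E_{X'}$ is the expectation with respect to $X'$ alone, for a fixed realisation of the sample $(V_i)$. -/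

import Mathlib

open MeasureTheory ProbabilityTheory Filter
open scoped Topology ContDiff

noncomputable section

/-! ### Hölder classes of functions on `ℝ^d`

Points of `ℝ^d` are functions `Fin d → ℝ`; Euclidean norms are taken through `WithLp.toLp 2`. -/

/-- The Euclidean norm of a vector of `ℝ^d`. -/
def euclNorm {d : ℕ} (x : Fin d → ℝ) : ℝ := ‖WithLp.toLp 2 x‖

/-- The classical partial derivative `∂φ/∂x_k`. -/
def partialDeriv {d : ℕ} (k : Fin d) (φ : (Fin d → ℝ) → ℝ) : (Fin d → ℝ) → ℝ :=
  fun x => fderiv ℝ φ x (Pi.single k 1)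

/-- The classical iterated partial derivative `∏ₖ ∂^{i k}/∂x_k^{i k}`; it is applied
to smooth functions only. -/
def multiDeriv {d : ℕ} (i : Fin d → ℕ) (φ : (Fin d → ℝ) → ℝ) : (Fin d → ℝ) → ℝ :=
  (List.finRange d).foldr (fun k ψ => (partialDeriv k)^[i k] ψ) φ

/-- `D` is a weak partial derivative of `f` on `ℝ^d` with multi-index `i`. -/
def IsWeakDeriv {d : ℕ} (i : Fin d → ℕ) (f D : (Fin d → ℝ) → ℝ) : Prop :=
  LocallyIntegrable f volume ∧ LocallyIntegrable D volume ∧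
    ∀ φ : (Fin d → ℝ) → ℝ, ContDiff ℝ ∞ φ → HasCompactSupport φ →
      ∫ x, f x * multiDeriv i φ x = (-1) ^ (∑ k, i k) * ∫ x, D x * φ x

/-- The Hölder class `H_α` of `α`-smooth functions on `ℝ^d`: the function has weak partial
derivatives up to order `α - 1`, and its Taylor polynomials of degree `α - 1` built on them
approximate it up to `K ‖x - y‖ ^ α`, for all `x` and `y`. -/
def HolderClass (d α : ℕ) : Set ((Fin d → ℝ) → ℝ) :=
  {M | ∃ D : (Fin d → ℕ) → (Fin d → ℝ) → ℝ,
    (∀ i : Fin d → ℕ, ∑ k, i k < α → IsWeakDeriv i M (D i)) ∧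
    ∃ K : ℝ, 0 < K ∧ ∀ x y : Fin d → ℝ,
      |M x - ∑ p ∈ Finset.range α, ∑ i ∈ Finset.piAntidiag Finset.univ p,
          D i y / (∏ k, ((i k).factorial : ℝ)) * ∏ k, (x k - y k) ^ i k|
        ≤ K * euclNorm (x - y) ^ α}

/-! ### The random inputs -/

/-- `X` is a random vector of independent continuous variables supported on `Ω`: the components
are independent, the `k`-th one has the probability density `g k`, the vector lies almost
surely in `Ω`, and the densities do not vanish on `Ω`. -/
structure IsIndepInput {d : ℕ} {T : Type*} [MeasurableSpace T] (Q : Measure T)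
    (X : T → Fin d → ℝ) (g : Fin d → ℝ → ℝ) (Ω : Set (Fin d → ℝ)) : Prop where
  measurable : ∀ k, Measurable fun t => X t k
  indep : iIndepFun (fun k t => X t k) Q
  measurable_density : ∀ k, Measurable (g k)
  density_nonneg : ∀ k a, 0 ≤ g k a
  law : ∀ k, Q.map (fun t => X t k) = volume.withDensity fun a => ENNReal.ofReal (g k a)
  mem_ae : ∀ᵐ t ∂Q, X t ∈ Ω
  density_pos : ∀ y ∈ Ω, ∀ k, 0 < g k (y k)

/-- The cumulative distribution function `G_k` of the `k`-th input. -/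
def inputCDF {d : ℕ} {T : Type*} [MeasurableSpace T] (Q : Measure T)
    (X : T → Fin d → ℝ) (k : Fin d) (a : ℝ) : ℝ :=
  cdf (Q.map fun t => X t k) a

/-- `V 0, V 1, …` is an i.i.d. sample of a random vector with independent, centred components of
variance `σ ^ 2`, all of whose odd moments vanish and all of whose even moments are finite. -/
structure IsPerturbationSample {d : ℕ} {S : Type*} [MeasurableSpace S] (P : Measure S)
    (V : ℕ → S → Fin d → ℝ) (σ : ℝ) : Prop where
  measurable : ∀ i k, Measurable fun s => V i s k
  indep : iIndepFun (fun (p : ℕ × Fin d) s => V p.1 s p.2) P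
  identDistrib : ∀ i k, IdentDistrib (fun s => V i s k) (fun s => V 0 s k) P P
  mean : ∀ k, ∫ s, V 0 s k ∂P = 0
  variance : ∀ k, ∫ s, V 0 s k ^ 2 ∂P = σ ^ 2
  odd_moment : ∀ k, ∀ q : ℕ, 1 ≤ q → ∫ s, V 0 s k ^ (2 * q + 1) ∂P = 0
  even_moment : ∀ k, ∀ q : ℕ, 1 ≤ q → Integrable (fun s => V 0 s k ^ (2 * q)) P

/-- The bandwidth restriction: `β_max h_j σ ≤ 1/2` for all `j`, or, in the form used for bounded
perturbations, `β_max h_j |V_j| ≤ 1` almost surely for all `j`. -/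
def BandwidthBound {d L : ℕ} {S : Type*} [MeasurableSpace S] (P : Measure S)
    (V₀ : S → Fin d → ℝ) (σ : ℝ) (β : Fin L → ℝ) (h : Fin d → ℝ) : Prop :=
  (∀ j l, |β l| * h j * σ ≤ 1 / 2) ∨ (∀ j l, ∀ᵐ s ∂P, |β l| * h j * |V₀ s j| ≤ 1)

/-! ### Estimators of cross-partial derivatives and the plug-in emulator -/

/-- The largest order `r* = min (p - 1) 3` below which the constraints on the coefficients
attached to derivatives of order `p` remove every term; used for `1 ≤ p`. -/
def rStar (p : ℕ) : ℕ := min (p - 1) 3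

/-- The constraints `∑ₗ C_l^{(p)} β_l^r = δ_{p,r}` for `r ∈ {0, 1, …, r*, p}`, for all orders
`p ∈ {1, …, d}`. -/
def CoeffConstraints (d : ℕ) {L : ℕ} (β : Fin L → ℝ) (C : ℕ → Fin L → ℝ) : Prop :=
  ∀ p : ℕ, 1 ≤ p → p ≤ d → ∀ r : ℕ, (r ≤ rStar p ∨ r = p) →
    ∑ l, C p l * β l ^ r = if r = p then 1 else 0

/-- The estimator, from the first `N` perturbations of the realised sample `V`, of the
cross-partial derivative of `M` with respect to the variables in `u`, at the point `y`. -/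
def derivEstimator {d L : ℕ} (M : (Fin d → ℝ) → ℝ) (β : Fin L → ℝ) (C : ℕ → Fin L → ℝ)
    (σ : ℝ) (h : Fin d → ℝ) (V : ℕ → Fin d → ℝ) (N : ℕ) (u : Finset (Fin d))
    (y : Fin d → ℝ) : ℝ :=
  (1 / (N : ℝ)) * ∑ i ∈ Finset.range N, ∑ l,
    C u.card l * M (fun k => y k + β l * h k * V i k) * ∏ k ∈ u, V i k / (h k * σ ^ 2)

/-- The weight `∏_{k ∈ v} (G_k(y_k) - 1[y_k ≥ x_k]) / g_k(y_k)` of the derivative-based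
ANOVA expansion. -/
def anovaWeight {d : ℕ} (G g : Fin d → ℝ → ℝ) (x : Fin d → ℝ) (v : Finset (Fin d))
    (y : Fin d → ℝ) : ℝ :=
  ∏ k ∈ v, (G k (y k) - Set.indicator (Set.Ici (x k)) 1 (y k)) / g k (y k)

/-- The plug-in emulator of `M` at `x`: the derivative-based ANOVA expansion in which every
cross-partial derivative is replaced by its estimator. The expectations are over the input `X`
alone, for a fixed realisation of the perturbations. -/
def emulator {d L : ℕ} {T : Type*} [MeasurableSpace T] (Q : Measure T) (X : T → Fin d → ℝ)
    (g : Fin d → ℝ → ℝ) (M : (Fin d → ℝ) → ℝ) (β : Fin L → ℝ) (C : ℕ → Fin L → ℝ)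
    (σ : ℝ) (h : Fin d → ℝ) (V : ℕ → Fin d → ℝ) (N : ℕ) (x : Fin d → ℝ) : ℝ :=
  (∫ t, M (X t) ∂Q) +
    ∑ v ∈ (Finset.univ : Finset (Finset (Fin d))).filter (fun v => 0 < v.card),
      ∫ t, derivEstimator M β C σ h V N v (X t) * anovaWeight (inputCDF Q X) g x v (X t) ∂Q

end

/-! ### Whitney jets of Hölder functions -/

/-! The pointwise Taylor estimate makes M a classical function with a Whitney jet. Two Taylor
polynomials based at points at distance at most ρ both approximate M to order ρ^(n+1) on a ball of
radius comparable to ρ, so their coefficients of order i differ by at most a constant times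
ρ^(n+1-|i|). The coefficients are therefore continuous, of polynomial growth, and derivatives of one
another. With n = d this gives continuous mixed partials D^v M for every set v of variables
(`exists_isMixedDerivFamily`).

In one variable, averaging φ(x) - φ(b) = ∫_b^x φ' over b and exchanging integrals gives φ(x) = E φ +
E[φ' w], where w = (G - 1[· ≥ x]) / g. Zeros of g do no harm: each projection of Ω is an interval on
which the density is positive, and outside it G already equals the indicator (`cdf_eq_indicator`).
Applying the formula one coordinate after another yields M(x) = Σ_v E[D^v M(X) ∏_{k∈v} w_k(X_k)]
(`anova_expansion`).

For a fixed sample, the emulator is E[M(X)] plus an average of ψ_N(V_i), where ψ_N depends on N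
through the bandwidth. Two facts suffice. Mean: the V_k are centred and independent, so values of M
may be replaced by mixed differences, which the mean value theorem turns into ∏(β h_k V_k) D^v M(ξ).
The bandwidths cancel, and dominated convergence with Σ C_l β_l^|v| = 1 gives the v-th term of the
expansion (`tendsto_integral_sampleTerm`). Second moment: the vanishing moments of the coefficients
up to r* remove the low Taylor orders, so the v-th summand of ψ_N is of size ‖h‖^(r*+1) / ∏_{k∈v}
h_k, and the assumption on h makes E[ψ_N²]/N tend to 0 (`integral_sampleTerm_sq_le`). Chebyshev's
inequality then gives convergence in probability (`tendstoInMeasure_average`). -/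

/-- The multi-indices of length `d` and order at most `n`. -/
def multiIdx (d n : ℕ) : Finset (Fin d → ℕ) :=
  (Finset.range (n + 1)).biUnion fun p => Finset.piAntidiag Finset.univ p

lemma mem_multiIdx {d n : ℕ} {m : Fin d → ℕ} : m ∈ multiIdx d n ↔ ∑ k, m k ≤ n := by
  simp [multiIdx]

lemma le_of_mem_multiIdx {d n : ℕ} {m : Fin d → ℕ} (hm : m ∈ multiIdx d n) (k : Fin d) :
    m k ≤ n :=
  (Finset.single_le_sum (f := m) (fun _ _ => Nat.zero_le _) (Finset.mem_univ k)).trans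
    (mem_multiIdx.1 hm)

/-- The coefficient functions `c m` provide Taylor polynomials of degree `n` for `M`, with a
remainder of order `n + 1`, uniformly in the base point. -/
def TaylorBound {d : ℕ} (n : ℕ) (M : (Fin d → ℝ) → ℝ) (c : (Fin d → ℕ) → (Fin d → ℝ) → ℝ)
    (K : ℝ) : Prop :=
  ∀ x y, |M x - ∑ m ∈ multiIdx d n, c m y * ∏ k, (x k - y k) ^ m k| ≤ K * ‖x - y‖ ^ (n + 1)

lemma norm_le_euclNorm {d : ℕ} (x : Fin d → ℝ) : ‖x‖ ≤ euclNorm x := by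
  refine (pi_norm_le_iff_of_nonneg (norm_nonneg _)).2 fun i => ?_
  exact PiLp.norm_apply_le (WithLp.toLp 2 x) i

lemma euclNorm_le {d : ℕ} (x : Fin d → ℝ) : euclNorm x ≤ √d * ‖x‖ := by
  unfold euclNorm
  rw [EuclideanSpace.norm_eq]
  have h0 : 0 ≤ √(d : ℝ) * ‖x‖ := by positivity
  apply Real.sqrt_le_iff.2 ⟨h0, ?_⟩
  rw [mul_pow, Real.sq_sqrt (by positivity)]
  calc ∑ i, ‖x i‖ ^ 2 ≤ ∑ _i : Fin d, ‖x‖ ^ 2 :=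
        Finset.sum_le_sum fun i _ => pow_le_pow_left₀ (norm_nonneg _) (norm_le_pi_norm x i) 2
    _ = _ := by simp

lemma euclNorm_nonneg {d : ℕ} (x : Fin d → ℝ) : 0 ≤ euclNorm x := norm_nonneg _

/-- The factorials are absorbed into the coefficients, and (√d)^(n+1) pays for passing from the
Euclidean norm to the sup norm, which is used from here on. -/
lemma exists_taylorBound {d n : ℕ} {M : (Fin d → ℝ) → ℝ} (hM : M ∈ HolderClass d (n + 1)) :
    ∃ c K, 0 ≤ K ∧ TaylorBound n M c K := by
  obtain ⟨D, -, K, hK, hD⟩ := hM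
  refine ⟨fun m y => D m y / ∏ k, ((m k).factorial : ℝ), K * (√d) ^ (n + 1), by positivity,
    fun x y => ?_⟩
  have := hD x y
  rw [multiIdx, Finset.sum_biUnion]
  · refine this.trans ?_
    rw [mul_assoc, ← mul_pow]
    gcongr
    · exact euclNorm_nonneg _
    · exact euclNorm_le _
  · intro p _ q _ hpq
    refine Finset.disjoint_left.2 fun m hm hm' => hpq ?_
    rw [Finset.mem_piAntidiag] at hm hm'
    exact hm.1.symm.trans hm'.1

/-- A polynomial of degree at most n is recovered from its values at n + 1 distinct nodes by
inverting the Vandermonde matrix. Neither Λ nor τ depends on w and ρ, which later makes all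
constants uniform in the scale. -/
lemma exists_coeff_functional_one (n : ℕ) : ∃ (Λ : ℕ → Fin (n + 1) → ℝ) (τ : Fin (n + 1) → ℝ),
    (∀ s, |τ s| ≤ 1) ∧ ∀ a m, a ≤ n → m ≤ n → ∀ w ρ : ℝ,
      ∑ s, Λ a s * (w + ρ * τ s) ^ m = m.choose a * w ^ (m - a) * ρ ^ a := by
  let τ : Fin (n + 1) → ℝ := fun s => (s : ℝ) / (n + 1)
  have hinj : Function.Injective τ := by
    intro s t hst
    have : (s : ℝ) = t := by
      have h1 : (n + 1 : ℝ) ≠ 0 := by positivity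
      simpa [τ, div_left_inj' h1] using hst
    exact Fin.ext (by exact_mod_cast this)
  have hdet : IsUnit (Matrix.vandermonde τ).det :=
    (Matrix.det_vandermonde_ne_zero_iff.2 hinj).isUnit
  have hinv := Matrix.nonsing_inv_mul _ hdet
  -- The value 0 for a > n is a mere default: the claim only concerns a ≤ n.
  refine ⟨fun a s => if ha : a < n + 1 then (Matrix.vandermonde τ)⁻¹ ⟨a, ha⟩ s else 0, τ, ?_, ?_⟩
  · intro s
    have h2 : (s : ℝ) ≤ n := by exact_mod_cast Nat.lt_succ_iff.1 s.2
    rw [abs_of_nonneg (by positivity), div_le_one (by positivity)]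
    linarith
  · intro a m ha hm w ρ
    have key : ∀ j ∈ Finset.range (m + 1), ∑ s, (Matrix.vandermonde τ)⁻¹ ⟨a, by omega⟩ s * τ s ^ j
        = if a = j then 1 else 0 := by
      intro j hj
      have hj' : j < n + 1 := by have := Finset.mem_range.1 hj; omega
      have := congrFun (congrFun hinv ⟨a, by omega⟩) ⟨j, hj'⟩
      simpa [Matrix.mul_apply, Matrix.vandermonde_apply, Matrix.one_apply] using this
    have ha' : a < n + 1 := by omega
    simp only [ha', dite_true]
    calc ∑ s, (Matrix.vandermonde τ)⁻¹ ⟨a, ha'⟩ s * (w + ρ * τ s) ^ m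
        = ∑ j ∈ Finset.range (m + 1), (m.choose j * w ^ (m - j) * ρ ^ j) *
            ∑ s, (Matrix.vandermonde τ)⁻¹ ⟨a, ha'⟩ s * τ s ^ j := by
          simp_rw [Finset.mul_sum]
          rw [Finset.sum_comm]
          refine Finset.sum_congr rfl fun s _ => ?_
          rw [add_comm w, add_pow, Finset.mul_sum]
          refine Finset.sum_congr rfl fun j _ => ?_
          rw [mul_pow]; ring
      _ = ∑ j ∈ Finset.range (m + 1), (m.choose j * w ^ (m - j) * ρ ^ j) *
            (if a = j then 1 else 0) :=
          Finset.sum_congr rfl fun j hj => by rw [key j hj]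
      _ = _ := by
          simp only [mul_ite, mul_one, mul_zero, Finset.sum_ite_eq, Finset.mem_range]
          split_ifs with h
          · rfl
          · rw [Nat.choose_eq_zero_of_lt (by omega)]; simp

/-- Tensor product of the one-dimensional functionals: the sum over the grid factors over the
coordinates. -/
lemma exists_coeff_functional (d n : ℕ) :
    ∃ (Λ : (Fin d → ℕ) → (Fin d → Fin (n + 1)) → ℝ) (τ : (Fin d → Fin (n + 1)) → Fin d → ℝ),
    (∀ s, ‖τ s‖ ≤ 1) ∧ ∀ i m : Fin d → ℕ, (∀ k, i k ≤ n) → (∀ k, m k ≤ n) →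
      ∀ (w : Fin d → ℝ) (ρ : ℝ), ∑ s, Λ i s * ∏ k, (w k + ρ * τ s k) ^ m k =
        (∏ k, ((m k).choose (i k) : ℝ) * w k ^ (m k - i k)) * ρ ^ ∑ k, i k := by
  obtain ⟨Λ, τ, hτ, hΛ⟩ := exists_coeff_functional_one n
  refine ⟨fun i s => ∏ k, Λ (i k) (s k), fun s k => τ (s k), fun s => ?_, ?_⟩
  · exact (pi_norm_le_iff_of_nonneg zero_le_one).2 fun k => hτ _
  · intro i m hi hm w ρ
    simp_rw [← Finset.prod_mul_distrib]
    rw [← Finset.prod_pow_eq_pow_sum, ← Finset.prod_mul_distrib]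
    have := Finset.prod_univ_sum (fun _ : Fin d => (Finset.univ : Finset (Fin (n + 1))))
      (fun k s => Λ (i k) s * (w k + ρ * τ s) ^ m k)
    rw [Fintype.piFinset_univ] at this
    rw [← this]
    exact Finset.prod_congr rfl fun k _ => hΛ _ _ (hi k) (hm k) _ _

lemma prod_choose_mul_zero_pow {d : ℕ} (i m : Fin d → ℕ) :
    (∏ k, ((m k).choose (i k) : ℝ) * (0 : ℝ) ^ (m k - i k)) = if m = i then 1 else 0 := by
  split_ifs with h
  · subst h; simp
  · obtain ⟨k, hk⟩ := Function.ne_iff.1 h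
    refine Finset.prod_eq_zero (Finset.mem_univ k) ?_
    rcases lt_or_gt_of_ne hk with h' | h'
    · simp [Nat.choose_eq_zero_of_lt h']
    · simp [Nat.sub_ne_zero_of_lt h']

/-- The coefficient of order `i` at `y + w` of the Taylor polynomial based at `y`. -/
def shiftedCoeff {d : ℕ} (n : ℕ) (c : (Fin d → ℕ) → (Fin d → ℝ) → ℝ) (i : Fin d → ℕ)
    (y w : Fin d → ℝ) : ℝ :=
  ∑ m ∈ multiIdx d n, c m y * ∏ k, ((m k).choose (i k) : ℝ) * w k ^ (m k - i k)

lemma shiftedCoeff_zero {d n : ℕ} (c : (Fin d → ℕ) → (Fin d → ℝ) → ℝ) {i : Fin d → ℕ}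
    (hi : ∑ k, i k ≤ n) (y : Fin d → ℝ) : shiftedCoeff n c i y 0 = c i y := by
  simp only [shiftedCoeff, Pi.zero_apply, prod_choose_mul_zero_pow, mul_ite, mul_one, mul_zero,
    Finset.sum_ite_eq', mem_multiIdx, if_pos hi]

/-- At the nodes y + w + ρ τ_s the polynomials based at y + w and at y are both close to M, hence to
each other, up to a multiple of ρ^(n+1). The functional of order i reads off the difference of the
i-th coefficients times ρ^|i|, and dividing by ρ^|i| gives the bound. -/
lemma TaylorBound.exists_shift_le_of_norm_le {d n : ℕ} {M : (Fin d → ℝ) → ℝ}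
    {c : (Fin d → ℕ) → (Fin d → ℝ) → ℝ} {K : ℝ} (hK : 0 ≤ K) (h : TaylorBound n M c K) :
    ∃ K', 0 ≤ K' ∧ ∀ i : Fin d → ℕ, ∑ k, i k ≤ n → ∀ (y w : Fin d → ℝ) (ρ : ℝ), 0 < ρ →
      ‖w‖ ≤ ρ → |c i (y + w) - shiftedCoeff n c i y w| ≤ K' * ρ ^ (n + 1 - ∑ k, i k) := by
  obtain ⟨Λ, τ, hτ, hΛ⟩ := exists_coeff_functional d n
  -- Summing over all i makes the constant independent of i; 2^(n+1) comes from ‖w + ρ τ_s‖ ≤ 2ρ.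
  refine ⟨(∑ i ∈ multiIdx d n, ∑ s, |Λ i s|) * (K + K * 2 ^ (n + 1)), by positivity, ?_⟩
  intro i hi y w ρ hρ hw
  have hi' : i ∈ multiIdx d n := mem_multiIdx.2 hi
  have hik := le_of_mem_multiIdx hi'
  have e1 : ∑ s, Λ i s * ∑ m ∈ multiIdx d n, c m (y + w) * ∏ k, (0 + ρ * τ s k) ^ m k
      = c i (y + w) * ρ ^ ∑ k, i k := by
    have hz := shiftedCoeff_zero c hi (y + w)
    rw [← hz, shiftedCoeff, Finset.sum_mul]
    simp_rw [Finset.mul_sum]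
    rw [Finset.sum_comm]
    refine Finset.sum_congr rfl fun m hm => ?_
    rw [mul_assoc]
    have h2 := hΛ i m hik (le_of_mem_multiIdx hm) 0 ρ
    simp only [Pi.zero_apply] at h2 ⊢
    rw [← h2, Finset.mul_sum]
    exact Finset.sum_congr rfl fun s _ => by ring
  have e2 : ∑ s, Λ i s * ∑ m ∈ multiIdx d n, c m y * ∏ k, (w k + ρ * τ s k) ^ m k
      = shiftedCoeff n c i y w * ρ ^ ∑ k, i k := by
    rw [shiftedCoeff, Finset.sum_mul]
    simp_rw [Finset.mul_sum]
    rw [Finset.sum_comm]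
    refine Finset.sum_congr rfl fun m hm => ?_
    rw [mul_assoc, ← hΛ i m hik (le_of_mem_multiIdx hm) w ρ, Finset.mul_sum]
    exact Finset.sum_congr rfl fun s _ => by ring
  have hpt : ∀ s, |∑ m ∈ multiIdx d n, c m (y + w) * ∏ k, (0 + ρ * τ s k) ^ m k -
      ∑ m ∈ multiIdx d n, c m y * ∏ k, (w k + ρ * τ s k) ^ m k|
        ≤ (K + K * 2 ^ (n + 1)) * ρ ^ (n + 1) := by
    intro s
    have hs : ‖ρ • τ s‖ ≤ ρ := by
      rw [norm_smul, Real.norm_of_nonneg hρ.le]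
      exact mul_le_of_le_one_right hρ.le (hτ s)
    have a1 := h (y + w + ρ • τ s) (y + w)
    have a2 := h (y + w + ρ • τ s) y
    have b1 : ‖y + w + ρ • τ s - (y + w)‖ ≤ ρ := by simpa using hs
    have b2 : ‖y + w + ρ • τ s - y‖ ≤ 2 * ρ := by
      have : y + w + ρ • τ s - y = w + ρ • τ s := by abel
      rw [this]; exact (norm_add_le _ _).trans (by linarith)
    have a1' := a1.trans (mul_le_mul_of_nonneg_left (pow_le_pow_left₀ (norm_nonneg _) b1 (n+1)) hK)
    have a2' := a2.trans (mul_le_mul_of_nonneg_left (pow_le_pow_left₀ (norm_nonneg _) b2 (n+1)) hK)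
    have c1 : ∀ k, (y + w + ρ • τ s) k - (y + w) k = 0 + ρ * τ s k := fun k => by simp
    have c2 : ∀ k, (y + w + ρ • τ s) k - y k = w k + ρ * τ s k := fun k => by
      simp only [Pi.add_apply, Pi.smul_apply, smul_eq_mul]; ring
    simp only [c1] at a1'
    simp only [c2] at a2'
    rw [mul_pow] at a2'
    rw [abs_le] at a1' a2' ⊢
    constructor <;> nlinarith
  have hmain : |c i (y + w) - shiftedCoeff n c i y w| * ρ ^ (∑ k, i k) ≤
      ((∑ i ∈ multiIdx d n, ∑ s, |Λ i s|) * (K + K * 2 ^ (n + 1))) * ρ ^ (n + 1) := by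
    have : |c i (y + w) - shiftedCoeff n c i y w| * ρ ^ (∑ k, i k) =
        |(c i (y + w) - shiftedCoeff n c i y w) * ρ ^ (∑ k, i k)| := by
      rw [abs_mul, abs_of_pos (pow_pos hρ _)]
    rw [this, sub_mul, ← e1, ← e2, ← Finset.sum_sub_distrib]
    calc _ ≤ ∑ s, |Λ i s| * ((K + K * 2 ^ (n + 1)) * ρ ^ (n + 1)) := by
          refine (Finset.abs_sum_le_sum_abs _ _).trans (Finset.sum_le_sum fun s _ => ?_)
          rw [← mul_sub, abs_mul]
          exact mul_le_mul_of_nonneg_left (hpt s) (abs_nonneg _)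
      _ = (∑ s, |Λ i s|) * ((K + K * 2 ^ (n + 1)) * ρ ^ (n + 1)) := by rw [Finset.sum_mul]
      _ ≤ (∑ i ∈ multiIdx d n, ∑ s, |Λ i s|) * ((K + K * 2 ^ (n + 1)) * ρ ^ (n + 1)) := by
          refine mul_le_mul_of_nonneg_right ?_ (by positivity)
          exact Finset.single_le_sum (f := fun i => ∑ s, |Λ i s|)
            (fun _ _ => Finset.sum_nonneg fun _ _ => abs_nonneg _) hi'
      _ = _ := by ring
  have hsplit : ρ ^ (n + 1) = ρ ^ (n + 1 - ∑ k, i k) * ρ ^ (∑ k, i k) := by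
    rw [← pow_add]; congr 1; omega
  rw [hsplit, ← mul_assoc] at hmain
  exact le_of_mul_le_mul_right hmain (pow_pos hρ _)

lemma continuous_shiftedCoeff {d n : ℕ} (c : (Fin d → ℕ) → (Fin d → ℝ) → ℝ) (i : Fin d → ℕ)
    (y : Fin d → ℝ) : Continuous (shiftedCoeff n c i y) := by
  unfold shiftedCoeff; fun_prop

/-- Let the free scale ρ decrease to ‖w‖; taking a limit also covers w = 0, where ρ = ‖w‖ is not
allowed. -/
lemma TaylorBound.exists_shift_le {d n : ℕ} {M : (Fin d → ℝ) → ℝ}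
    {c : (Fin d → ℕ) → (Fin d → ℝ) → ℝ} {K : ℝ} (hK : 0 ≤ K) (h : TaylorBound n M c K) :
    ∃ K', 0 ≤ K' ∧ ∀ i : Fin d → ℕ, ∑ k, i k ≤ n → ∀ y w : Fin d → ℝ,
      |c i (y + w) - shiftedCoeff n c i y w| ≤ K' * ‖w‖ ^ (n + 1 - ∑ k, i k) := by
  obtain ⟨K', hK', hb⟩ := h.exists_shift_le_of_norm_le hK
  refine ⟨K', hK', fun i hi y w => ?_⟩
  have ht : Tendsto (fun ρ : ℝ => K' * ρ ^ (n + 1 - ∑ k, i k)) (𝓝[>] ‖w‖)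
      (𝓝 (K' * ‖w‖ ^ (n + 1 - ∑ k, i k))) := by
    refine Tendsto.mono_left ?_ nhdsWithin_le_nhds
    exact (by fun_prop : Continuous fun ρ : ℝ => K' * ρ ^ (n + 1 - ∑ k, i k)).tendsto _
  refine ge_of_tendsto ht ?_
  filter_upwards [self_mem_nhdsWithin] with ρ hρ
  exact hb i hi y w ρ ((norm_nonneg _).trans_lt hρ) (le_of_lt hρ)

lemma TaylorBound.continuous_coeff {d n : ℕ} {M : (Fin d → ℝ) → ℝ}
    {c : (Fin d → ℕ) → (Fin d → ℝ) → ℝ} {K : ℝ} (hK : 0 ≤ K) (h : TaylorBound n M c K)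
    {i : Fin d → ℕ} (hi : ∑ k, i k ≤ n) : Continuous (c i) := by
  obtain ⟨K', hK', hb⟩ := h.exists_shift_le hK
  refine continuous_iff_continuousAt.2 fun y => ?_
  have h1 : Tendsto (fun x => shiftedCoeff n c i y (x - y)) (𝓝 y) (𝓝 (c i y)) := by
    have := ((continuous_shiftedCoeff (n := n) c i y).comp (continuous_sub_right y)).tendsto y
    simpa [shiftedCoeff_zero c hi, Function.comp_def] using this
  have h2 : Tendsto (fun x => c i x - shiftedCoeff n c i y (x - y)) (𝓝 y) (𝓝 0) := by
    have hg : Tendsto (fun x : Fin d → ℝ => K' * ‖x - y‖ ^ (n + 1 - ∑ k, i k)) (𝓝 y) (𝓝 0) := by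
      have := (by fun_prop :
        Continuous fun x : Fin d → ℝ => K' * ‖x - y‖ ^ (n + 1 - ∑ k, i k)).tendsto y
      simpa [zero_pow (show n + 1 - ∑ k, i k ≠ 0 by omega)] using this
    refine squeeze_zero_norm (fun x => ?_) hg
    have := hb i hi y (x - y)
    rwa [add_sub_cancel] at this
  have := h2.add h1
  simpa [ContinuousAt] using this

lemma TaylorBound.coeff_zero {d n : ℕ} {M : (Fin d → ℝ) → ℝ}
    {c : (Fin d → ℕ) → (Fin d → ℝ) → ℝ} {K : ℝ} (h : TaylorBound n M c K) : c 0 = M := by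
  funext y
  have h1 := h y y
  have h2 := shiftedCoeff_zero (n := n) c (i := 0) (by simp) y
  simp only [shiftedCoeff, Pi.zero_apply, Nat.choose_zero_right, Nat.cast_one, one_mul,
    Nat.sub_zero] at h2
  simp only [sub_self, norm_zero, h2] at h1
  simp only [ne_eq, Nat.add_eq_zero_iff, one_ne_zero, and_false, not_false_eq_true, zero_pow,
    mul_zero, abs_nonpos_iff] at h1
  linarith

lemma prod_abs_pow_le {d : ℕ} (w : Fin d → ℝ) (m : Fin d → ℕ) :
    ∏ k, |w k| ^ m k ≤ ‖w‖ ^ ∑ k, m k := by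
  rw [← Finset.prod_pow_eq_pow_sum]
  exact Finset.prod_le_prod (fun _ _ => by positivity)
    fun k _ => pow_le_pow_left₀ (abs_nonneg _) (norm_le_pi_norm w k) _

/-- Compare with the Taylor polynomial at the origin: the shifted coefficient has degree at most n -
|i| in y, and the error adds one more power. -/
lemma TaylorBound.exists_growth {d n : ℕ} {M : (Fin d → ℝ) → ℝ}
    {c : (Fin d → ℕ) → (Fin d → ℝ) → ℝ} {K : ℝ} (hK : 0 ≤ K) (h : TaylorBound n M c K) :
    ∃ K', 0 ≤ K' ∧ ∀ i : Fin d → ℕ, ∑ k, i k ≤ n → ∀ y,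
      |c i y| ≤ K' * (1 + ‖y‖) ^ (n + 1 - ∑ k, i k) := by
  obtain ⟨K', hK', hb⟩ := h.exists_shift_le hK
  obtain ⟨b, hb'⟩ : ∃ b : (Fin d → ℕ) → ℝ, ∀ i, b i =
      ∑ m ∈ multiIdx d n, |c m 0| * ∏ k, ((m k).choose (i k) : ℝ) := ⟨_, fun _ => rfl⟩
  have hb0 : ∀ i, 0 ≤ b i := fun i => by rw [hb']; positivity
  obtain ⟨B, hB⟩ : ∃ B : ℝ, B = ∑ i ∈ multiIdx d n, b i := ⟨_, rfl⟩
  have hB0 : 0 ≤ B := hB ▸ Finset.sum_nonneg fun i _ => hb0 i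
  refine ⟨B + K', by positivity, fun i hi y => ?_⟩
  have hy : 1 ≤ 1 + ‖y‖ := by linarith [norm_nonneg y]
  have h1 : |shiftedCoeff n c i 0 y| ≤ B * (1 + ‖y‖) ^ (n + 1 - ∑ k, i k) := by
    calc |shiftedCoeff n c i 0 y|
        ≤ ∑ m ∈ multiIdx d n, (|c m 0| * ∏ k, ((m k).choose (i k) : ℝ)) *
            (1 + ‖y‖) ^ (n + 1 - ∑ k, i k) := by
          refine (Finset.abs_sum_le_sum_abs _ _).trans (Finset.sum_le_sum fun m hm => ?_)
          rw [abs_mul, mul_assoc, Finset.prod_mul_distrib, abs_mul]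
          refine mul_le_mul_of_nonneg_left ?_ (abs_nonneg _)
          by_cases hmi : ∀ k, i k ≤ m k
          · rw [abs_of_nonneg (by positivity), Finset.abs_prod]
            refine mul_le_mul_of_nonneg_left ?_ (by positivity)
            simp_rw [abs_pow]
            refine (prod_abs_pow_le y _).trans ?_
            refine (pow_le_pow_left₀ (norm_nonneg y) (by linarith) _).trans
              (pow_le_pow_right₀ hy ?_)
            have hs : ∑ k, (m k - i k) + ∑ k, i k = ∑ k, m k := by
              rw [← Finset.sum_add_distrib]
              exact Finset.sum_congr rfl fun k _ => Nat.sub_add_cancel (hmi k)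
            have := mem_multiIdx.1 hm
            omega
          · push Not at hmi
            obtain ⟨k, hk⟩ := hmi
            have : ∏ k, ((m k).choose (i k) : ℝ) = 0 :=
              Finset.prod_eq_zero (Finset.mem_univ k) (by simp [Nat.choose_eq_zero_of_lt hk])
            simp [this]
      _ ≤ B * (1 + ‖y‖) ^ (n + 1 - ∑ k, i k) := by
          rw [← Finset.sum_mul, ← hb', hB]
          refine mul_le_mul_of_nonneg_right ?_ (by positivity)
          exact Finset.single_le_sum (fun j _ => hb0 j) (mem_multiIdx.2 hi)
  have h2 := hb i hi 0 y
  rw [zero_add] at h2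
  have h3 : K' * ‖y‖ ^ (n + 1 - ∑ k, i k) ≤ K' * (1 + ‖y‖) ^ (n + 1 - ∑ k, i k) := by
    gcongr; linarith
  have h4 := abs_sub_abs_le_abs_sub (c i y) (shiftedCoeff n c i 0 y)
  linarith

/-- Along the k-th axis only the monomial m = i + e_k is linear in t, and its binomial factor is i_k
+ 1. Any other m is killed by a factor off the axis or has exponent different from 1 in t. -/
lemma hasDerivAt_shiftedCoeff {d n : ℕ} (c : (Fin d → ℕ) → (Fin d → ℝ) → ℝ) {i : Fin d → ℕ}
    (k : Fin d) (hi : ∑ j, i j < n) (y : Fin d → ℝ) :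
    HasDerivAt (fun t : ℝ => shiftedCoeff n c i y (Pi.single k t))
      ((i k + 1) * c (i + Pi.single k 1) y) 0 := by
  have hterm : ∀ m ∈ multiIdx d n, HasDerivAt (fun t : ℝ => c m y *
      ∏ j, ((m j).choose (i j) : ℝ) * (Pi.single k t : Fin d → ℝ) j ^ (m j - i j))
      (if m = i + Pi.single k 1 then (i k + 1) * c (i + Pi.single k 1) y else 0) 0 := by
    intro m _
    have hprod : ∀ t : ℝ,
        ∏ j, ((m j).choose (i j) : ℝ) * (Pi.single k t : Fin d → ℝ) j ^ (m j - i j)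
        = ((m k).choose (i k) * t ^ (m k - i k)) *
          ∏ j ∈ Finset.univ.erase k, ((m j).choose (i j) : ℝ) * 0 ^ (m j - i j) := by
      intro t
      rw [← Finset.mul_prod_erase _ _ (Finset.mem_univ k)]
      congr 1
      · simp
      · refine Finset.prod_congr rfl fun j hj => ?_
        rw [Pi.single_eq_of_ne (Finset.ne_of_mem_erase hj)]
    simp_rw [hprod]
    have hd : HasDerivAt (fun t : ℝ => t ^ (m k - i k))
        (((m k - i k : ℕ) : ℝ) * 0 ^ (m k - i k - 1)) 0 := hasDerivAt_pow _ _
    have hd2 := (((hd.const_mul ((m k).choose (i k) : ℝ)).mul_const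
      (∏ j ∈ Finset.univ.erase k, ((m j).choose (i j) : ℝ) * 0 ^ (m j - i j))).const_mul (c m y))
    refine hd2.congr_deriv (Eq.symm ?_)
    split_ifs with hm
    · subst hm
      have : ∏ j ∈ Finset.univ.erase k, (((i + Pi.single k 1 : Fin d → ℕ) j).choose (i j) : ℝ) *
          0 ^ ((i + Pi.single k 1 : Fin d → ℕ) j - i j) = 1 := by
        refine Finset.prod_eq_one fun j hj => ?_
        simp [Pi.single_eq_of_ne (Finset.ne_of_mem_erase hj)]
      rw [this]
      simp
      ring
    · by_cases hoff : ∃ j, j ≠ k ∧ m j ≠ i j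
      · obtain ⟨j, hjk, hj⟩ := hoff
        have : ∏ j ∈ Finset.univ.erase k, ((m j).choose (i j) : ℝ) * 0 ^ (m j - i j) = 0 := by
          refine Finset.prod_eq_zero (Finset.mem_erase.2 ⟨hjk, Finset.mem_univ j⟩) ?_
          rcases lt_or_gt_of_ne hj with h' | h'
          · simp [Nat.choose_eq_zero_of_lt h']
          · simp [Nat.sub_ne_zero_of_lt h']
        simp [this]
      · push Not at hoff
        have hk : m k ≠ i k + 1 := by
          intro hk
          refine hm (funext fun j => ?_)
          by_cases hj : j = k
          · subst hj; simp [hk]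
          · simp [hoff j hj, Pi.single_eq_of_ne hj]
        have : ((m k - i k : ℕ) : ℝ) * 0 ^ (m k - i k - 1) = 0 := by
          rcases Nat.eq_zero_or_pos (m k - i k) with h0 | h0
          · simp [h0]
          · rw [zero_pow (by omega), mul_zero]
        simp [this]
  have := HasDerivAt.fun_sum hterm
  rw [Finset.sum_ite_eq', if_pos] at this
  · exact this
  · rw [mem_multiIdx]
    simp only [Pi.add_apply, Finset.sum_add_distrib, Finset.sum_pi_single', Finset.mem_univ,
      if_true]
    omega

/-- Since |i| < n, the shift error has exponent n + 1 - |i| ≥ 2 and is o(t). The factor i_k + 1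
appears because the coefficients are derivatives divided by factorials. -/
lemma TaylorBound.hasDerivAt_coeff {d n : ℕ} {M : (Fin d → ℝ) → ℝ}
    {c : (Fin d → ℕ) → (Fin d → ℝ) → ℝ} {K : ℝ} (hK : 0 ≤ K) (h : TaylorBound n M c K)
    {i : Fin d → ℕ} (k : Fin d) (hi : ∑ j, i j < n) (y : Fin d → ℝ) :
    HasDerivAt (fun t : ℝ => c i (Function.update y k t))
      ((i k + 1) * c (i + Pi.single k 1) y) (y k) := by
  obtain ⟨K', hK', hb⟩ := h.exists_shift_le hK
  have h1 := hasDerivAt_shiftedCoeff (n := n) c k hi y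
  have h2 : HasDerivAt (fun t : ℝ => c i (y + Pi.single k t)
      - shiftedCoeff n c i y (Pi.single k t)) 0 0 := by
    refine HasDerivAt.of_isLittleO ?_ |>.congr_deriv rfl
    simp only [Pi.single_zero, add_zero, shiftedCoeff_zero c hi.le, sub_self, sub_zero, smul_zero]
    refine Asymptotics.IsBigO.trans_isLittleO (g := fun t : ℝ => t ^ (n + 1 - ∑ k, i k)) ?_ ?_
    · refine Asymptotics.IsBigO.of_bound K' (Eventually.of_forall fun t => ?_)
      have := hb i hi.le y (Pi.single k t)
      rw [Pi.norm_single] at this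
      rwa [norm_pow]
    · exact Asymptotics.isLittleO_pow_id (by omega)
  have h3 := h2.add h1
  have h4 : HasDerivAt (fun t : ℝ => c i (y + Pi.single k t))
      ((i k + 1) * c (i + Pi.single k 1) y) 0 := by
    refine (h3.congr_deriv (zero_add _)).congr_of_eventuallyEq (Eventually.of_forall fun t => ?_)
    simp
  have h5 := HasDerivAt.comp_sub_const (y k) (y k) (f := fun t : ℝ => c i (y + Pi.single k t))
    (by simpa using h4)
  refine h5.congr_of_eventuallyEq (Eventually.of_forall fun t => ?_)
  simp only
  congr 1
  funext j
  by_cases hj : j = k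
  · subst hj; simp
  · simp [Function.update_of_ne hj, Pi.single_eq_of_ne hj]

/-- `Φ u` is the mixed partial derivative of `Φ ∅` with respect to the variables in `u`. -/
structure IsMixedDerivFamily {d : ℕ} (Φ : Finset (Fin d) → (Fin d → ℝ) → ℝ) : Prop where
  continuous : ∀ u, Continuous (Φ u)
  hasDerivAt : ∀ u k, k ∉ u → ∀ y,
    HasDerivAt (fun t : ℝ => Φ u (Function.update y k t)) (Φ (insert k u) y) (y k)

/-- Take the coefficients at 0/1 multi-indices: their order is at most d, the factors i_k + 1 are
all 1, and a non-empty u lowers the growth exponent d + 1 - |u| to at most d. -/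
lemma exists_isMixedDerivFamily {d : ℕ} {M : (Fin d → ℝ) → ℝ} (hM : M ∈ HolderClass d (d + 1)) :
    ∃ Φ, IsMixedDerivFamily Φ ∧ Φ ∅ = M ∧ ∃ K, 0 ≤ K ∧ (∀ y, |M y| ≤ K * (1 + ‖y‖) ^ (d + 1)) ∧
      ∀ u : Finset (Fin d), u.Nonempty → ∀ y, |Φ u y| ≤ K * (1 + ‖y‖) ^ d := by
  obtain ⟨c, K₀, hK₀, hc⟩ := exists_taylorBound hM
  obtain ⟨K, hK, hg⟩ := hc.exists_growth hK₀
  let ind : Finset (Fin d) → Fin d → ℕ := fun u k => if k ∈ u then 1 else 0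
  have hind : ∀ u, ∑ k, ind u k = u.card := fun u => by simp [ind]
  have hle : ∀ u, ∑ k, ind u k ≤ d := fun u => by
    rw [hind]; simpa using u.card_le_univ
  have h0 : ind ∅ = 0 := by funext k; simp [ind]
  refine ⟨fun u => c (ind u), ⟨fun u => hc.continuous_coeff hK₀ (hle u), fun u k hk y => ?_⟩,
    ?_, K, hK, fun y => ?_, fun u hu y => ?_⟩
  · have hlt : ∑ j, ind u j < d := by
      rw [hind]
      have := Finset.card_lt_univ_of_notMem hk
      simpa using this
    have hins : ind (insert k u) = ind u + Pi.single k 1 := by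
      funext j
      by_cases hj : j = k
      · subst hj; simp [ind, hk]
      · simp [ind, hj]
    have := hc.hasDerivAt_coeff hK₀ k hlt y
    rw [hins]
    convert! this using 1
    simp [ind, hk]
  · simp only [h0]; exact hc.coeff_zero
  · have := hg 0 (by simp) y
    rw [hc.coeff_zero] at this
    simpa using this
  · refine (hg _ (hle u) y).trans ?_
    rw [hind]
    have := hu.card_pos
    gcongr
    · linarith [norm_nonneg y]
    · omega

/-! ### Cancellation of low Taylor orders by the coefficient constraints -/

/-- A monomial of order q in the Taylor expansion is multiplied by Σ C_l β_l^q, so only orders above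
r survive. Orders r + 1 to n and the remainder of order n + 1 are all dominated by ‖z‖^(r+1) (1 +
‖z‖)^n. The growth in y is only n: order 0, the one coefficient of growth n + 1, has cancelled. -/
lemma exists_abs_sum_mul_le {d n L : ℕ} {M : (Fin d → ℝ) → ℝ} (hM : M ∈ HolderClass d (n + 1))
    (β C : Fin L → ℝ) {r : ℕ} (hr : r ≤ n) (hC : ∀ q ≤ r, ∑ l, C l * β l ^ q = 0) :
    ∃ K, 0 ≤ K ∧ ∀ y z : Fin d → ℝ, |∑ l, C l * M (fun k => y k + β l * z k)| ≤
      K * (‖z‖ ^ (r + 1) * (1 + ‖z‖) ^ n * (1 + ‖y‖) ^ n) := by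
  obtain ⟨c, K₀, hK₀, hc⟩ := exists_taylorBound hM
  obtain ⟨K, hK, hg⟩ := hc.exists_growth hK₀
  let A : ℝ := ∑ m ∈ multiIdx d n, |∑ l, C l * β l ^ ∑ k, m k| * K
  let B : ℝ := ∑ l, |C l| * (K₀ * |β l| ^ (n + 1))
  have hA : 0 ≤ A := by positivity
  have hB : 0 ≤ B := by positivity
  refine ⟨A + B, by positivity, fun y z => ?_⟩
  have hy : 1 ≤ 1 + ‖y‖ := by linarith [norm_nonneg y]
  have hz : 1 ≤ 1 + ‖z‖ := by linarith [norm_nonneg z]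
  have hpow : ∀ p, r + 1 ≤ p → p ≤ n + 1 → ‖z‖ ^ p ≤ ‖z‖ ^ (r + 1) * (1 + ‖z‖) ^ n := by
    intro p h1 h2
    obtain ⟨e, rfl⟩ := Nat.exists_eq_add_of_le h1
    rw [pow_add]
    refine mul_le_mul_of_nonneg_left ?_ (by positivity)
    exact (pow_le_pow_left₀ (norm_nonneg z) (by linarith) _).trans
      (pow_le_pow_right₀ hz (by omega))
  let T : Fin L → ℝ := fun l => ∑ m ∈ multiIdx d n, c m y * ∏ k, (β l * z k) ^ m k
  have hrem : ∀ l, |M (fun k => y k + β l * z k) - T l| ≤ K₀ * |β l| ^ (n + 1) * ‖z‖ ^ (n + 1) := by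
    intro l
    have h1 := hc (fun k => y k + β l * z k) y
    have h2 : (fun k => y k + β l * z k) - y = β l • z := by
      funext k; simp
    rw [h2, norm_smul, mul_pow, Real.norm_eq_abs, ← mul_assoc] at h1
    simpa [T] using h1
  have hpoly : ∑ l, C l * T l =
      ∑ m ∈ multiIdx d n, (∑ l, C l * β l ^ ∑ k, m k) * (c m y * ∏ k, z k ^ m k) := by
    simp_rw [T, Finset.mul_sum, Finset.sum_mul]
    rw [Finset.sum_comm]
    refine Finset.sum_congr rfl fun m _ => Finset.sum_congr rfl fun l _ => ?_
    simp_rw [mul_pow]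
    rw [Finset.prod_mul_distrib, Finset.prod_pow_eq_pow_sum]
    ring
  have hsplit : ∑ l, C l * M (fun k => y k + β l * z k) =
      ∑ l, C l * T l + ∑ l, C l * (M (fun k => y k + β l * z k) - T l) := by
    rw [← Finset.sum_add_distrib]
    exact Finset.sum_congr rfl fun l _ => by ring
  have hE : (0 : ℝ) ≤ ‖z‖ ^ (r + 1) * (1 + ‖z‖) ^ n := by positivity
  have h1 : |∑ l, C l * T l| ≤ A * (‖z‖ ^ (r + 1) * (1 + ‖z‖) ^ n * (1 + ‖y‖) ^ n) := by
    rw [hpoly, Finset.sum_mul]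
    refine (Finset.abs_sum_le_sum_abs _ _).trans (Finset.sum_le_sum fun m hm => ?_)
    rw [abs_mul, mul_assoc]
    refine (le_or_gt (∑ k, m k) r).elim (fun h => ?_) (fun h => ?_)
    · simp [hC _ h]
    · refine mul_le_mul_of_nonneg_left ?_ (abs_nonneg _)
      have hm' := mem_multiIdx.1 hm
      have e1 : |c m y| ≤ K * (1 + ‖y‖) ^ n := by
        refine (hg m hm' y).trans ?_
        gcongr
        omega
      have e2 : |∏ k, z k ^ m k| ≤ ‖z‖ ^ (r + 1) * (1 + ‖z‖) ^ n := by
        rw [Finset.abs_prod]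
        simp_rw [abs_pow]
        exact (prod_abs_pow_le z m).trans (hpow _ h (by omega))
      rw [abs_mul]
      calc |c m y| * |∏ k, z k ^ m k|
          ≤ (K * (1 + ‖y‖) ^ n) * (‖z‖ ^ (r + 1) * (1 + ‖z‖) ^ n) := by gcongr
        _ = _ := by ring
  have h2 : |∑ l, C l * (M (fun k => y k + β l * z k) - T l)| ≤
      B * (‖z‖ ^ (r + 1) * (1 + ‖z‖) ^ n * (1 + ‖y‖) ^ n) := by
    rw [Finset.sum_mul]
    refine (Finset.abs_sum_le_sum_abs _ _).trans (Finset.sum_le_sum fun l _ => ?_)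
    rw [abs_mul, mul_assoc]
    refine mul_le_mul_of_nonneg_left ((hrem l).trans ?_) (abs_nonneg _)
    refine mul_le_mul_of_nonneg_left ?_ (by positivity)
    refine (hpow _ (by omega) le_rfl).trans (le_mul_of_one_le_right hE (one_le_pow₀ hy))
  rw [hsplit, add_mul]
  exact (abs_add_le _ _).trans (add_le_add h1 h2)

/-! ### The one-dimensional derivative-based expansion -/

/-- The kernel `1[b ≤ a] - 1[x ≤ a]`, which represents `φ x - φ b` in terms of `φ'`. -/
noncomputable def stepKernel (x b a : ℝ) : ℝ := Set.indicator (Set.Ici b) 1 a - Set.indicator (Set.Ici x) 1 a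

lemma measurable_stepKernel (x : ℝ) : Measurable fun p : ℝ × ℝ => stepKernel x p.1 p.2 := by
  have h1 : Measurable fun p : ℝ × ℝ => Set.indicator {q : ℝ × ℝ | q.1 ≤ q.2} (1 : ℝ × ℝ → ℝ) p :=
    measurable_one.indicator (measurableSet_le measurable_fst measurable_snd)
  have h2 : Measurable fun p : ℝ × ℝ => Set.indicator (Set.Ici x) (1 : ℝ → ℝ) p.2 :=
    (measurable_one.indicator measurableSet_Ici).comp measurable_snd
  exact h1.sub h2

lemma stepKernel_of_le {x b : ℝ} (h : b ≤ x) :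
    stepKernel x b = Set.indicator (Set.Ico b x) 1 := by
  funext a
  simp only [stepKernel, Set.indicator_apply, Set.mem_Ici, Set.mem_Ico, Pi.one_apply]
  split_ifs <;> grind

lemma stepKernel_of_ge {x b : ℝ} (h : x ≤ b) :
    stepKernel x b = fun a => -Set.indicator (Set.Ico x b) 1 a := by
  funext a
  simp only [stepKernel, Set.indicator_apply, Set.mem_Ici, Set.mem_Ico, Pi.one_apply]
  split_ifs <;> grind

lemma integral_mul_stepKernel (f : ℝ → ℝ) (x b : ℝ) :
    ∫ a, f a * stepKernel x b a = ∫ a in b..x, f a := by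
  have key : ∀ s t : ℝ, ∫ a, f a * Set.indicator (Set.Ico s t) 1 a = ∫ a in Set.Ioc s t, f a := by
    intro s t
    rw [← integral_Ico_eq_integral_Ioc, ← integral_indicator measurableSet_Ico]
    refine integral_congr_ae (Eventually.of_forall fun a => ?_)
    simp only [Set.indicator_apply, Pi.one_apply]
    split_ifs <;> simp
  rcases le_total b x with h | h
  · rw [stepKernel_of_le h, intervalIntegral.integral_of_le h, key]
  · rw [stepKernel_of_ge h, intervalIntegral.integral_of_ge h, ← key, ← integral_neg]
    simp

/-- If |a| > |b| + |x|, then b and x lie on the same side of a and the two indicators cancel. -/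
lemma abs_stepKernel_le (x b a : ℝ) :
    |stepKernel x b a| ≤ Set.indicator {p : ℝ × ℝ | |p.2| ≤ |p.1| + |x|} 1 (b, a) := by
  by_cases h : |a| ≤ |b| + |x|
  · rw [Set.indicator_of_mem (by exact h)]
    simp only [stepKernel, Set.indicator_apply, Set.mem_Ici, Pi.one_apply]
    split_ifs <;> simp
  · rw [Set.indicator_of_notMem (by exact h)]
    push Not at h
    simp only [stepKernel, Set.indicator_apply, Set.mem_Ici, Pi.one_apply]
    have hb1 := neg_abs_le b
    have hb2 := le_abs_self b
    have hx1 := neg_abs_le x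
    have hx2 := le_abs_self x
    have hb0 := abs_nonneg b
    have hx0 := abs_nonneg x
    rcases abs_cases a with ⟨h1, h2⟩ | ⟨h1, h2⟩
    · rw [if_pos (by linarith), if_pos (by linarith)]; simp
    · rw [if_neg (by linarith), if_neg (by linarith)]; simp

/-- For fixed b the kernel lives on an interval of length 2(|b| + |x|), on which f is at most K (1 +
|b| + |x|)^n. Integrating in a costs one power of |b|, hence the moment of order n + 1. -/
lemma integrable_mul_stepKernel {ν : Measure ℝ} [IsProbabilityMeasure ν] {n : ℕ}
    (hν : Integrable (fun a => (1 + |a|) ^ (n + 1)) ν) (x : ℝ) {f : ℝ → ℝ} (hf : Measurable f)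
    {K : ℝ} (hfK : ∀ a, |f a| ≤ K * (1 + |a|) ^ n) :
    Integrable (fun p : ℝ × ℝ => f p.2 * stepKernel x p.1 p.2) (ν.prod volume) := by
  have hK : 0 ≤ K := by
    have := (abs_nonneg _).trans (hfK 0)
    simpa using this
  let S : Set (ℝ × ℝ) := {p | |p.2| ≤ |p.1| + |x|}
  have hS : MeasurableSet S := measurableSet_le (by fun_prop) (by fun_prop)
  have hsec : ∀ b a, S.indicator (1 : ℝ × ℝ → ℝ) (b, a) =
      (Set.Icc (-(|b| + |x|)) (|b| + |x|)).indicator (1 : ℝ → ℝ) a := by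
    intro b a
    simp only [Set.indicator_apply, S, Set.mem_ofPred_eq, Set.mem_Icc, abs_le, Pi.one_apply]
  let g : ℝ × ℝ → ℝ := fun p => K * (1 + |p.1| + |x|) ^ n * S.indicator 1 p
  have hgm : Measurable g := by
    refine Measurable.mul (by fun_prop) (measurable_one.indicator hS)
  have hgi : ∀ b, Integrable (fun a => S.indicator (1 : ℝ × ℝ → ℝ) (b, a)) volume := by
    intro b
    simp_rw [hsec]
    exact (integrable_indicator_iff measurableSet_Icc).2 (integrableOn_const (by simp))
  have hg : Integrable g (ν.prod volume) := by
    refine (integrable_prod_iff hgm.aestronglyMeasurable).2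
      ⟨Eventually.of_forall fun b => (hgi b).const_mul (K * (1 + |b| + |x|) ^ n), ?_⟩
    have hval : ∀ b, ∫ a, ‖g (b, a)‖ = K * (1 + |b| + |x|) ^ n * (2 * (|b| + |x|)) := by
      intro b
      have h1 : ∀ a, ‖g (b, a)‖ = K * (1 + |b| + |x|) ^ n *
          (Set.Icc (-(|b| + |x|)) (|b| + |x|)).indicator (1 : ℝ → ℝ) a := by
        intro a
        rw [← hsec, Real.norm_of_nonneg]
        exact mul_nonneg (by positivity) (Set.indicator_nonneg (fun _ _ => zero_le_one) _)
      simp_rw [h1]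
      rw [integral_const_mul, integral_indicator measurableSet_Icc]
      simp only [Pi.one_apply, integral_const, smul_eq_mul, mul_one, measureReal_restrict_apply,
        MeasurableSet.univ, Set.univ_inter, Real.volume_real_Icc]
      rw [max_eq_left (by linarith [abs_nonneg b, abs_nonneg x])]
      ring
    simp_rw [hval]
    refine (hν.const_mul (2 * K * (1 + |x|) ^ (n + 1))).mono' (by fun_prop)
      (Eventually.of_forall fun b => ?_)
    rw [Real.norm_of_nonneg (by positivity)]
    have h1 : 1 + |b| + |x| ≤ (1 + |x|) * (1 + |b|) := by
      nlinarith [mul_nonneg (abs_nonneg x) (abs_nonneg b)]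
    calc K * (1 + |b| + |x|) ^ n * (2 * (|b| + |x|))
        ≤ K * ((1 + |x|) * (1 + |b|)) ^ n * (2 * ((1 + |x|) * (1 + |b|))) := by
          gcongr; linarith
      _ = 2 * K * (1 + |x|) ^ (n + 1) * (1 + |b|) ^ (n + 1) := by rw [mul_pow]; ring
  refine hg.mono' ((hf.comp measurable_snd).mul (measurable_stepKernel x)).aestronglyMeasurable
    (Eventually.of_forall fun p => ?_)
  obtain ⟨b, a⟩ := p
  rw [norm_mul, Real.norm_eq_abs, Real.norm_eq_abs]
  by_cases h : (b, a) ∈ S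
  · have h1 := abs_stepKernel_le x b a
    refine mul_le_mul ?_ h1 (abs_nonneg _) (by positivity)
    refine (hfK a).trans ?_
    have h2 : |a| ≤ |b| + |x| := h
    refine mul_le_mul_of_nonneg_left (pow_le_pow_left₀ (by positivity) ?_ n) hK
    change 1 + |a| ≤ 1 + |b| + |x|
    linarith
  · have h1 := abs_stepKernel_le x b a
    rw [Set.indicator_of_notMem h] at h1
    have h2 : |stepKernel x b a| = 0 := le_antisymm h1 (abs_nonneg _)
    rw [h2]
    simp [g, Set.indicator_of_notMem h]

lemma integral_stepKernel {ν : Measure ℝ} [IsProbabilityMeasure ν] (x a : ℝ) :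
    ∫ b, stepKernel x b a ∂ν = cdf ν a - Set.indicator (Set.Ici x) 1 a := by
  have h1 : ∀ b, Set.indicator (Set.Ici b) (1 : ℝ → ℝ) a = Set.indicator (Set.Iic a) 1 b := by
    intro b; simp [Set.indicator_apply]
  simp only [stepKernel, h1]
  rw [integral_sub, integral_indicator_one measurableSet_Iic, cdf_eq_real]
  · simp
  · exact (integrable_const (1 : ℝ)).indicator measurableSet_Iic
  · exact integrable_const _

/-- `w` represents the centred evaluation at `x` in terms of derivatives, for functions whose
derivative grows at most with the power `n`. -/
structure IsExpansionWeight (n : ℕ) (ν : Measure ℝ) (w : ℝ → ℝ) (x : ℝ) : Prop where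
  measurable : Measurable w
  moment : Integrable (fun a => (1 + |a|) ^ (n + 1)) ν
  integrable : Integrable (fun a => (1 + |a|) ^ n * |w a|) ν
  apply_eq : ∀ (φ φ' : ℝ → ℝ) (K : ℝ), Continuous φ' → (∀ a, HasDerivAt φ (φ' a) a) →
    (∀ a, |φ' a| ≤ K * (1 + |a|) ^ n) → φ x = ∫ a, φ a ∂ν + ∫ a, φ' a * w a ∂ν

/-- Average φ(x) - φ(b) = ∫ φ'(a) 1[b ≤ a] - φ'(a) 1[x ≤ a] da over b and use Fubini: the kernel
averages to G(a) - 1[x ≤ a], which is the density times the weight. -/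
lemma isExpansionWeight_of_density {ν : Measure ℝ} [IsProbabilityMeasure ν] {n : ℕ}
    (hν : Integrable (fun a => (1 + |a|) ^ (n + 1)) ν) {γ : ℝ → ℝ} (hγ : Measurable γ)
    (hγ0 : ∀ a, 0 ≤ γ a) (hlaw : ν = volume.withDensity fun a => ENNReal.ofReal (γ a)) {x : ℝ}
    (hx : ∀ a, γ a = 0 → cdf ν a = Set.indicator (Set.Ici x) 1 a) :
    IsExpansionWeight n ν (fun a => (cdf ν a - Set.indicator (Set.Ici x) 1 a) / γ a) x := by
  set w : ℝ → ℝ := fun a => (cdf ν a - Set.indicator (Set.Ici x) 1 a) / γ a with hw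
  have hwm : Measurable w :=
    (((monotone_cdf ν).measurable).sub (measurable_one.indicator measurableSet_Ici)).div hγ
  have hγw : ∀ a, γ a * w a = cdf ν a - Set.indicator (Set.Ici x) 1 a := by
    intro a
    -- Division by zero gives the weight 0 here; `hx` says that the numerator vanishes too, so
    -- nothing is lost.
    by_cases h : γ a = 0
    · rw [h, zero_mul, hx a h, sub_self]
    · rw [hw, mul_div_cancel₀ _ h]
  have hγn : Measurable fun a => (γ a).toNNReal := hγ.real_toNNReal
  have hν' : ν = volume.withDensity fun a => ((γ a).toNNReal : ENNReal) := hlaw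
  have hsmul : ∀ (f : ℝ → ℝ) a, (γ a).toNNReal • (f a * w a) =
      f a * ∫ b, stepKernel x b a ∂ν := by
    intro f a
    rw [integral_stepKernel, ← hγw, NNReal.smul_def, smul_eq_mul, Real.coe_toNNReal _ (hγ0 a)]
    ring
  have hint : ∀ f : ℝ → ℝ, Measurable f → ∀ K, (∀ a, |f a| ≤ K * (1 + |a|) ^ n) →
      Integrable (fun a => f a * w a) ν := by
    intro f hf K hK
    have h1 := (integrable_mul_stepKernel hν x hf hK).integral_prod_right
    simp only [integral_const_mul] at h1
    have h2 : Integrable (fun a => f a * w a)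
        (volume.withDensity fun a => ((γ a).toNNReal : ENNReal)) := by
      refine (integrable_withDensity_iff_integrable_smul hγn).2 ?_
      simp_rw [hsmul]
      exact h1
    exact hν' ▸ h2
  have hval : ∀ f : ℝ → ℝ, ∫ a, f a * w a ∂ν = ∫ a, f a * ∫ b, stepKernel x b a ∂ν := by
    intro f
    have h1 := integral_withDensity_eq_integral_smul (μ := volume) hγn (fun a => f a * w a)
    rw [← hν'] at h1
    rw [h1]
    simp_rw [hsmul]
  refine ⟨hwm, hν, ?_, ?_⟩
  -- The integrability of the weight is that of the admissible test function (1 + |a|)^n.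
  · have := (hint (fun a => (1 + |a|) ^ n) (by fun_prop) 1
      (fun a => by rw [one_mul, abs_of_nonneg (by positivity)])).norm
    refine this.congr (Eventually.of_forall fun a => ?_)
    simp only [norm_mul, Real.norm_eq_abs]
    rw [abs_of_nonneg (by positivity : 0 ≤ (1 + |a|) ^ n)]
  · intro φ φ' K hc hd hK
    have h1 := integrable_mul_stepKernel hν x hc.measurable hK
    have h2 : ∀ b, ∫ a, φ' a * stepKernel x b a = φ x - φ b := fun b => by
      rw [integral_mul_stepKernel, intervalIntegral.integral_eq_sub_of_hasDerivAt
        (fun a _ => hd a) (hc.intervalIntegrable _ _)]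
    have h3 := h1.integral_prod_left
    simp only [h2] at h3
    have h4 : Integrable φ ν := by
      have := (integrable_const (φ x)).sub h3
      refine this.congr (Eventually.of_forall fun a => ?_)
      simp
    have h5 := integral_integral_swap (f := fun b a => φ' a * stepKernel x b a) h1
    simp only [h2, integral_const_mul] at h5
    rw [hval, ← h5, integral_sub (integrable_const _) h4]
    simp

/-! ### Product measures -/

/-- Resampling one coordinate independently does not change a product law. This gives Fubini in a
single coordinate without splitting the index set; the overwritten coordinate is a dummy of total
mass 1. -/
lemma measurePreserving_update {d : ℕ} (ν : Fin d → Measure ℝ) [∀ k, IsProbabilityMeasure (ν k)]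
    (k : Fin d) : MeasurePreserving (fun p : (Fin d → ℝ) × ℝ => Function.update p.1 k p.2)
      ((Measure.pi ν).prod (ν k)) (Measure.pi ν) := by
  refine ⟨measurable_update', (Measure.pi_eq fun s hs => ?_).symm⟩
  rw [Measure.map_apply measurable_update' (MeasurableSet.univ_pi hs)]
  have : (fun p : (Fin d → ℝ) × ℝ => Function.update p.1 k p.2) ⁻¹' Set.univ.pi s =
      (Set.univ.pi (Function.update s k Set.univ)) ×ˢ s k := by
    ext ⟨y, a⟩
    simp only [Set.mem_preimage, Set.mem_pi, Set.mem_univ, true_imp_iff, Set.mem_prod]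
    constructor
    · intro h
      refine ⟨fun j => ?_, by simpa using h k⟩
      by_cases hj : j = k
      · subst hj; simp
      · simpa [Function.update_of_ne hj] using h j
    · rintro ⟨h1, h2⟩ j
      by_cases hj : j = k
      · subst hj; simpa using h2
      · simpa [Function.update_of_ne hj] using h1 j
  rw [this, Measure.prod_prod, Measure.pi_pi]
  rw [← Finset.prod_erase_mul _ _ (Finset.mem_univ k),
    ← Finset.prod_erase_mul _ (fun i => ν i (s i)) (Finset.mem_univ k)]
  simp only [Function.update_self, measure_univ, mul_one]
  congr 1
  refine Finset.prod_congr rfl fun j hj => ?_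
  rw [Function.update_of_ne (Finset.ne_of_mem_erase hj)]

lemma integrable_update {d : ℕ} {ν : Fin d → Measure ℝ} [∀ k, IsProbabilityMeasure (ν k)]
    (k : Fin d) {F : (Fin d → ℝ) → ℝ} (hF : Integrable F (Measure.pi ν)) :
    Integrable (fun p : (Fin d → ℝ) × ℝ => F (Function.update p.1 k p.2))
      ((Measure.pi ν).prod (ν k)) :=
  (measurePreserving_update ν k).integrable_comp_of_integrable hF

lemma integral_eq_integral_update {d : ℕ} {ν : Fin d → Measure ℝ}
    [∀ k, IsProbabilityMeasure (ν k)] (k : Fin d) {F : (Fin d → ℝ) → ℝ}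
    (hF : Integrable F (Measure.pi ν)) :
    ∫ y, F y ∂Measure.pi ν =
      ∫ y, ∫ a, F (Function.update y k a) ∂ν k ∂Measure.pi ν := by
  rw [← integral_prod _ (integrable_update k hF)]
  have hmp := measurePreserving_update ν k
  conv_lhs => rw [← hmp.map_eq]
  rw [integral_map hmp.measurable.aemeasurable]
  rw [hmp.map_eq]; exact hF.aestronglyMeasurable

lemma one_add_norm_pow_le {d : ℕ} (y : Fin d → ℝ) (n : ℕ) :
    (1 + ‖y‖) ^ n ≤ 1 + ∑ j, (1 + |y j|) ^ n := by
  have h0 : ∀ j ∈ Finset.univ, 0 ≤ (1 + |y j|) ^ n := fun j _ => by positivity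
  rcases isEmpty_or_nonempty (Fin d) with h | h
  · simp [Subsingleton.elim y 0]
  · obtain ⟨j, hj⟩ : ∃ j, ‖y‖ = ‖y j‖ := by
      obtain ⟨j, hj⟩ := Finite.exists_max fun j => ‖y j‖
      exact ⟨j, le_antisymm ((pi_norm_le_iff_of_nonneg (norm_nonneg _)).2 hj) (norm_le_pi_norm y j)⟩
    have := Finset.single_le_sum h0 (Finset.mem_univ j)
    rw [hj, Real.norm_eq_abs]
    linarith

lemma integrable_one_add_norm_pow {d : ℕ} {ν : Fin d → Measure ℝ}
    [∀ k, IsProbabilityMeasure (ν k)] {n : ℕ} (h : ∀ k, Integrable (fun a => (1 + |a|) ^ n) (ν k)) :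
    Integrable (fun y : Fin d → ℝ => (1 + ‖y‖) ^ n) (Measure.pi ν) := by
  have hs : Integrable (fun y : Fin d → ℝ => 1 + ∑ j, (1 + |y j|) ^ n) (Measure.pi ν) := by
    refine (integrable_const _).add (integrable_finsetSum _ fun j _ => ?_)
    exact (measurePreserving_eval ν j).integrable_comp_of_integrable (h j)
  refine hs.mono' (by fun_prop) (Eventually.of_forall fun y => ?_)
  rw [Real.norm_of_nonneg (by positivity)]
  exact one_add_norm_pow_le y n

/-- The power of the norm is at most 1 plus the sum of the powers of the coordinates, and each
resulting term is a product of functions of one coordinate. The coordinate carrying the power uses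
the weighted bound if it is in u and the moment if it is not. -/
lemma integrable_one_add_norm_pow_mul_weight {d n : ℕ} {ν : Fin d → Measure ℝ}
    [∀ k, IsProbabilityMeasure (ν k)] {w : Fin d → ℝ → ℝ} {x : Fin d → ℝ}
    (hw : ∀ k, IsExpansionWeight n (ν k) (w k) (x k)) (u : Finset (Fin d)) :
    Integrable (fun y : Fin d → ℝ => (1 + ‖y‖) ^ n * |∏ k ∈ u, w k (y k)|) (Measure.pi ν) := by
  have hone : ∀ a : ℝ, 1 ≤ 1 + |a| := fun a => by linarith [abs_nonneg a]
  have hwi : ∀ k, Integrable (fun a => |w k a|) (ν k) := fun k => by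
    refine (hw k).integrable.mono' (hw k).measurable.abs.aestronglyMeasurable
      (Eventually.of_forall fun a => ?_)
    rw [Real.norm_of_nonneg (abs_nonneg _)]
    exact le_mul_of_one_le_left (abs_nonneg _) (one_le_pow₀ (hone a))
  have hmi : ∀ k, Integrable (fun a => (1 + |a|) ^ n) (ν k) := fun k => by
    refine (hw k).moment.mono' (by fun_prop) (Eventually.of_forall fun a => ?_)
    rw [Real.norm_of_nonneg (by positivity)]
    exact pow_le_pow_right₀ (hone a) (Nat.le_succ n)
  have hmeas : Measurable fun y : Fin d → ℝ => |∏ k ∈ u, w k (y k)| := by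
    have : ∀ k, Measurable (w k) := fun k => (hw k).measurable
    fun_prop
  have habs : ∀ y : Fin d → ℝ, |∏ k ∈ u, w k (y k)| = ∏ k, if k ∈ u then |w k (y k)| else 1 := by
    intro y
    rw [Finset.abs_prod, Finset.prod_ite_mem, Finset.univ_inter]
  have h0 : Integrable (fun y : Fin d → ℝ => |∏ k ∈ u, w k (y k)|) (Measure.pi ν) := by
    simp_rw [habs]
    refine Integrable.fintype_prod (f := fun k a => if k ∈ u then |w k a| else 1) fun k => ?_
    by_cases hk : k ∈ u
    · simpa [hk] using hwi k
    · simp [hk]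
  have hj : ∀ j, Integrable (fun y : Fin d → ℝ => (1 + |y j|) ^ n * |∏ k ∈ u, w k (y k)|)
      (Measure.pi ν) := by
    intro j
    have : ∀ y : Fin d → ℝ, (1 + |y j|) ^ n * |∏ k ∈ u, w k (y k)| =
        ∏ k, ((if k = j then (1 + |y k|) ^ n else 1) * if k ∈ u then |w k (y k)| else 1) := by
      intro y
      rw [Finset.prod_mul_distrib, habs, Finset.prod_ite_eq' Finset.univ j]
      simp
    simp_rw [this]
    refine Integrable.fintype_prod
      (f := fun k a => (if k = j then (1 + |a|) ^ n else 1) * if k ∈ u then |w k a| else 1)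
      fun k => ?_
    by_cases hk : k ∈ u <;> by_cases hkj : k = j
    · subst hkj; simpa [hk] using (hw k).integrable
    · simpa [hk, hkj] using hwi k
    · subst hkj; simpa [hk] using hmi k
    · simp [hk, hkj]
  refine (h0.add (integrable_finsetSum Finset.univ fun j _ => hj j)).mono'
    (Measurable.aestronglyMeasurable (by fun_prop)) (Eventually.of_forall fun y => ?_)
  rw [Real.norm_of_nonneg (by positivity), Pi.add_apply, ← Finset.sum_mul, ← one_add_mul]
  exact mul_le_mul_of_nonneg_right (one_add_norm_pow_le y n) (abs_nonneg _)

/-! ### The derivative-based ANOVA expansion -/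

lemma one_add_norm_update_le {d : ℕ} (z : Fin d → ℝ) (k : Fin d) (a : ℝ) :
    1 + ‖Function.update z k a‖ ≤ (1 + ‖z‖) * (1 + |a|) := by
  have h0 := norm_nonneg z
  have ha := abs_nonneg a
  have : ‖Function.update z k a‖ ≤ ‖z‖ + |a| := by
    refine (pi_norm_le_iff_of_nonneg (by positivity)).2 fun j => ?_
    by_cases hj : j = k
    · subst hj; simp
    · rw [Function.update_of_ne hj]
      exact (norm_le_pi_norm z j).trans (by linarith)
  nlinarith

lemma one_add_norm_piecewise_le {d : ℕ} (A : Finset (Fin d)) (x y : Fin d → ℝ) :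
    1 + ‖A.piecewise x y‖ ≤ (1 + ‖x‖) * (1 + ‖y‖) := by
  have h0 := norm_nonneg x
  have h1 := norm_nonneg y
  have : ‖A.piecewise x y‖ ≤ ‖x‖ + ‖y‖ := by
    refine (pi_norm_le_iff_of_nonneg (by positivity)).2 fun j => ?_
    by_cases hj : j ∈ A
    · rw [Finset.piecewise_eq_of_mem _ _ _ hj]
      exact (norm_le_pi_norm x j).trans (by linarith)
    · rw [Finset.piecewise_eq_of_notMem _ _ _ hj]
      exact (norm_le_pi_norm y j).trans (by linarith)
  nlinarith

lemma continuous_piecewise_left {d : ℕ} (A : Finset (Fin d)) (x : Fin d → ℝ) :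
    Continuous fun y : Fin d → ℝ => A.piecewise x y := by
  refine continuous_pi fun j => ?_
  by_cases hj : j ∈ A
  · simp only [Finset.piecewise_eq_of_mem _ _ _ hj]; fun_prop
  · simp only [Finset.piecewise_eq_of_notMem _ _ _ hj]; fun_prop

section Expansion

variable {d n : ℕ} {ν : Fin d → Measure ℝ} [∀ k, IsProbabilityMeasure (ν k)]
  {w : Fin d → ℝ → ℝ} {x : Fin d → ℝ} {Φ : Finset (Fin d) → (Fin d → ℝ) → ℝ} {K : ℝ}

lemma integrable_mul_weight (hw : ∀ k, IsExpansionWeight n (ν k) (w k) (x k))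
    {f : (Fin d → ℝ) → ℝ} (hf : Measurable f) {K : ℝ} (u : Finset (Fin d))
    (hK : ∀ y, |f y| ≤ K * (1 + ‖y‖) ^ n) :
    Integrable (fun y => f y * ∏ k ∈ u, w k (y k)) (Measure.pi ν) := by
  have hwm : ∀ k, Measurable (w k) := fun k => (hw k).measurable
  refine ((integrable_one_add_norm_pow_mul_weight hw u).const_mul K).mono'
    (Measurable.aestronglyMeasurable (by fun_prop)) (Eventually.of_forall fun y => ?_)
  rw [norm_mul, Real.norm_eq_abs, Real.norm_eq_abs, ← mul_assoc]
  exact mul_le_mul_of_nonneg_right (hK y) (abs_nonneg _)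

/-- The coordinates in A are frozen at x. The undifferentiated term has growth n + 1 but carries no
weight, so the moment suffices; the others have growth n and use the weights. -/
lemma integrable_partial_expansion (hw : ∀ k, IsExpansionWeight n (ν k) (w k) (x k))
    (hΦ : IsMixedDerivFamily Φ) (hK : 0 ≤ K) (h0 : ∀ y, |Φ ∅ y| ≤ K * (1 + ‖y‖) ^ (n + 1))
    (h1 : ∀ u : Finset (Fin d), u.Nonempty → ∀ y, |Φ u y| ≤ K * (1 + ‖y‖) ^ n)
    (A u : Finset (Fin d)) :
    Integrable (fun y => Φ u (A.piecewise x y) * ∏ k ∈ u, w k (y k)) (Measure.pi ν) := by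
  have hm : Measurable fun y => Φ u (A.piecewise x y) :=
    ((hΦ.continuous u).comp (continuous_piecewise_left A x)).measurable
  have hle : ∀ m y, K * (1 + ‖A.piecewise x y‖) ^ m ≤ K * (1 + ‖x‖) ^ m * (1 + ‖y‖) ^ m := by
    intro m y
    rw [mul_assoc, ← mul_pow]
    gcongr
    exact one_add_norm_piecewise_le A x y
  rcases u.eq_empty_or_nonempty with rfl | hu
  · simp only [Finset.prod_empty, mul_one]
    refine ((integrable_one_add_norm_pow fun k => (hw k).moment).const_mul
      (K * (1 + ‖x‖) ^ (n + 1))).mono' hm.aestronglyMeasurable (Eventually.of_forall fun y => ?_)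
    exact (h0 _).trans (hle _ y)
  · exact integrable_mul_weight hw hm u fun y => (h1 u hu _).trans (hle _ y)

lemma piecewise_update_right {A : Finset (Fin d)} {k : Fin d} (hk : k ∉ A) (x y : Fin d → ℝ)
    (a : ℝ) : A.piecewise x (Function.update y k a) = Function.update (A.piecewise x y) k a := by
  funext j
  by_cases hj : j = k
  · subst hj; simp [hk]
  · by_cases hA : j ∈ A <;> simp [hA, hj]

/-- Freezing one more coordinate is the one-dimensional formula in that coordinate, the others being
fixed: either average over it, or differentiate and weight. -/
lemma integral_expansion_step (hw : ∀ k, IsExpansionWeight n (ν k) (w k) (x k))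
    (hΦ : IsMixedDerivFamily Φ) (hK : 0 ≤ K) (h0 : ∀ y, |Φ ∅ y| ≤ K * (1 + ‖y‖) ^ (n + 1))
    (h1 : ∀ u : Finset (Fin d), u.Nonempty → ∀ y, |Φ u y| ≤ K * (1 + ‖y‖) ^ n)
    {A u : Finset (Fin d)} {k : Fin d} (hkA : k ∉ A) (hku : k ∉ u) :
    ∫ y, Φ u ((insert k A).piecewise x y) * ∏ j ∈ u, w j (y j) ∂Measure.pi ν =
      ∫ y, Φ u (A.piecewise x y) * ∏ j ∈ u, w j (y j) ∂Measure.pi ν +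
      ∫ y, Φ (insert k u) (A.piecewise x y) * ∏ j ∈ insert k u, w j (y j) ∂Measure.pi ν := by
  have i1 := integrable_partial_expansion hw hΦ hK h0 h1 A u
  have i2 := integrable_partial_expansion hw hΦ hK h0 h1 A (insert k u)
  have j1 := (integrable_update k i1).integral_prod_left
  have j2 := (integrable_update k i2).integral_prod_left
  rw [integral_eq_integral_update k i1, integral_eq_integral_update k i2, ← integral_add j1 j2]
  refine integral_congr_ae (Eventually.of_forall fun y => ?_)
  set z := A.piecewise x y with hz
  have hprod : ∀ a, ∏ j ∈ u, w j (Function.update y k a j) = ∏ j ∈ u, w j (y j) := fun a =>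
    Finset.prod_congr rfl fun j hj => by
      rw [Function.update_of_ne (ne_of_mem_of_not_mem hj hku)]
  simp only [piecewise_update_right hkA, Finset.prod_insert hku, hprod, Function.update_self,
    ← hz]
  rw [Finset.piecewise_insert, ← hz, integral_mul_const]
  have e2 : ∫ a, Φ (insert k u) (Function.update z k a) * (w k a * ∏ j ∈ u, w j (y j)) ∂ν k =
      (∫ a, Φ (insert k u) (Function.update z k a) * w k a ∂ν k) * ∏ j ∈ u, w j (y j) := by
    rw [← integral_mul_const]
    exact integral_congr_ae (Eventually.of_forall fun a => by simp only; ring)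
  rw [e2, ← add_mul]
  congr 1
  refine (hw k).apply_eq (fun a => Φ u (Function.update z k a))
    (fun a => Φ (insert k u) (Function.update z k a)) (K * (1 + ‖z‖) ^ n)
    ((hΦ.continuous _).comp (continuous_const.update k continuous_id)) (fun a => ?_) (fun a => ?_)
  · have := hΦ.hasDerivAt u k hku (Function.update z k a)
    simpa only [Function.update_idem, Function.update_self] using this
  · refine (h1 _ (Finset.insert_nonempty _ _) _).trans ?_
    rw [mul_assoc, ← mul_pow]
    gcongr
    exact one_add_norm_update_le z k a

/-- Induction on the frozen set; the statement is over all u disjoint from A because each step adds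
the new coordinate to u in one of its two terms. With A everything and u empty, the left side is the
value at x. -/
lemma integral_expansion (hw : ∀ k, IsExpansionWeight n (ν k) (w k) (x k))
    (hΦ : IsMixedDerivFamily Φ) (hK : 0 ≤ K) (h0 : ∀ y, |Φ ∅ y| ≤ K * (1 + ‖y‖) ^ (n + 1))
    (h1 : ∀ u : Finset (Fin d), u.Nonempty → ∀ y, |Φ u y| ≤ K * (1 + ‖y‖) ^ n)
    (A : Finset (Fin d)) : ∀ u : Finset (Fin d), Disjoint A u →
    ∫ y, Φ u (A.piecewise x y) * ∏ j ∈ u, w j (y j) ∂Measure.pi ν =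
      ∑ v ∈ A.powerset, ∫ y, Φ (v ∪ u) y * ∏ j ∈ v ∪ u, w j (y j) ∂Measure.pi ν := by
  induction A using Finset.induction_on with
  | empty => intro u _; simp
  | insert k A hk ih =>
    intro u hu
    rw [Finset.disjoint_insert_left] at hu
    rw [integral_expansion_step hw hΦ hK h0 h1 hk hu.1, ih u hu.2, ih (insert k u)
      (Finset.disjoint_insert_right.2 ⟨hk, hu.2⟩), Finset.sum_powerset_insert hk]
    simp only [Finset.union_insert, Finset.insert_union]

theorem anova_expansion (hw : ∀ k, IsExpansionWeight n (ν k) (w k) (x k))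
    (hΦ : IsMixedDerivFamily Φ) (hK : 0 ≤ K) (h0 : ∀ y, |Φ ∅ y| ≤ K * (1 + ‖y‖) ^ (n + 1))
    (h1 : ∀ u : Finset (Fin d), u.Nonempty → ∀ y, |Φ u y| ≤ K * (1 + ‖y‖) ^ n) :
    Φ ∅ x = ∑ v, ∫ y, Φ v y * ∏ j ∈ v, w j (y j) ∂Measure.pi ν := by
  have := integral_expansion hw hΦ hK h0 h1 Finset.univ ∅ (by simp)
  simpa using this

end Expansion

/-! ### Mixed differences -/

/-- The mixed difference of `F` between `z` and the points obtained from `z` by replacing some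
of the coordinates in `v` by zero. -/
noncomputable def mixedDiff {d : ℕ} (v : Finset (Fin d)) (F : (Fin d → ℝ) → ℝ)
    (z : Fin d → ℝ) : ℝ :=
  ∑ A ∈ v.powerset, (-1) ^ A.card * F (A.piecewise 0 z)

lemma mixedDiff_insert {d : ℕ} {v : Finset (Fin d)} {k : Fin d} (hk : k ∉ v)
    (F : (Fin d → ℝ) → ℝ) (z : Fin d → ℝ) :
    mixedDiff (insert k v) F z = mixedDiff v F z - mixedDiff v F (Function.update z k 0) := by
  unfold mixedDiff
  rw [Finset.sum_powerset_insert hk, sub_eq_add_neg, ← Finset.sum_neg_distrib]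
  congr 1
  refine Finset.sum_congr rfl fun A hA => ?_
  have hkA : k ∉ A := fun h => hk (Finset.mem_powerset.1 hA h)
  rw [Finset.card_insert_of_notMem hkA, Finset.piecewise_insert, piecewise_update_right hkA]
  simp only [Pi.zero_apply]
  ring

lemma exists_eq_mul_of_hasDerivAt {f f' : ℝ → ℝ} (hf : ∀ a, HasDerivAt f (f' a) a) (t : ℝ) :
    ∃ c, |c| ≤ |t| ∧ f t - f 0 = t * f' c := by
  have hc : Continuous f := continuous_iff_continuousAt.2 fun a => (hf a).continuousAt
  rcases lt_trichotomy t 0 with h | h | h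
  · obtain ⟨c, hc1, hc2⟩ := exists_hasDerivAt_eq_slope f f' h hc.continuousOn fun a _ => hf a
    refine ⟨c, ?_, ?_⟩
    · rw [abs_of_neg h, abs_of_neg hc1.2]; linarith [hc1.1]
    · rw [hc2]; field_simp; ring
  · exact ⟨0, by simp, by simp [h]⟩
  · obtain ⟨c, hc1, hc2⟩ := exists_hasDerivAt_eq_slope f f' h hc.continuousOn fun a _ => hf a
    refine ⟨c, ?_, ?_⟩
    · rw [abs_of_pos h, abs_of_pos hc1.1]; linarith [hc1.2]
    · rw [hc2]; field_simp; ring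

lemma IsMixedDerivFamily.hasDerivAt_update {d : ℕ} {Φ : Finset (Fin d) → (Fin d → ℝ) → ℝ}
    (hΦ : IsMixedDerivFamily Φ) {u : Finset (Fin d)} {k : Fin d} (hk : k ∉ u) (z : Fin d → ℝ)
    (a : ℝ) : HasDerivAt (fun t : ℝ => Φ u (Function.update z k t))
      (Φ (insert k u) (Function.update z k a)) a := by
  simpa only [Function.update_idem, Function.update_self] using
    hΦ.hasDerivAt u k hk (Function.update z k a)

/-- Mean value theorem in one coordinate at a time: the derivative of the mixed difference in a new
variable k is the mixed difference of Φ (insert k u), to which the induction hypothesis applies. -/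
lemma IsMixedDerivFamily.exists_mixedDiff_eq {d : ℕ} {Φ : Finset (Fin d) → (Fin d → ℝ) → ℝ}
    (hΦ : IsMixedDerivFamily Φ) (v : Finset (Fin d)) : ∀ u : Finset (Fin d), Disjoint v u →
      ∀ z, ∃ ξ : Fin d → ℝ, (∀ j, |ξ j| ≤ |z j|) ∧
        mixedDiff v (Φ u) z = (∏ k ∈ v, z k) * Φ (v ∪ u) ξ := by
  induction v using Finset.induction_on with
  | empty => intro u _ z; exact ⟨z, fun _ => le_rfl, by simp [mixedDiff]⟩
  | insert k v hk ih =>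
    intro u hu z
    rw [Finset.disjoint_insert_left] at hu
    have hd : ∀ a, HasDerivAt (fun t : ℝ => mixedDiff v (Φ u) (Function.update z k t))
        (mixedDiff v (Φ (insert k u)) (Function.update z k a)) a := by
      intro a
      unfold mixedDiff
      refine HasDerivAt.fun_sum fun A hA => HasDerivAt.const_mul _ ?_
      have hkA : k ∉ A := fun h => hk (Finset.mem_powerset.1 hA h)
      simp only [piecewise_update_right hkA]
      exact hΦ.hasDerivAt_update hu.1 _ a
    obtain ⟨c, hc, hc'⟩ := exists_eq_mul_of_hasDerivAt hd (z k)
    obtain ⟨ξ, hξ, hξ'⟩ := ih (insert k u) (Finset.disjoint_insert_right.2 ⟨hk, hu.2⟩)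
      (Function.update z k c)
    refine ⟨ξ, fun j => (hξ j).trans ?_, ?_⟩
    · by_cases hj : j = k
      · subst hj; simpa using hc
      · rw [Function.update_of_ne hj]
    · rw [mixedDiff_insert hk]
      simp only [Function.update_eq_self] at hc'
      have hprod : ∏ j ∈ v, Function.update z k c j = ∏ j ∈ v, z j :=
        Finset.prod_congr rfl fun j hj => Function.update_of_ne (ne_of_mem_of_not_mem hj hk) _ _
      rw [hc', hξ', hprod, Finset.prod_insert hk, Finset.union_insert, Finset.insert_union]
      ring

lemma IsMixedDerivFamily.translate {d : ℕ} {Φ : Finset (Fin d) → (Fin d → ℝ) → ℝ}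
    (hΦ : IsMixedDerivFamily Φ) (y : Fin d → ℝ) : IsMixedDerivFamily fun u z => Φ u (y + z) := by
  refine ⟨fun u => (hΦ.continuous u).comp (continuous_const.add continuous_id),
    fun u k hk z => ?_⟩
  have h1 := hΦ.hasDerivAt u k hk (y + z)
  have h2 := HasDerivAt.comp_const_add (y k) (z k) (f := fun t => Φ u (Function.update (y + z) k t))
    (by simpa using h1)
  refine h2.congr_of_eventuallyEq (Eventually.of_forall fun t => ?_)
  simp only
  congr 1
  funext j
  by_cases hj : j = k
  · subst hj; simp
  · simp [hj]

/-! ### Mean of the derivative estimators -/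

lemma norm_mul_le_of_abs_le {d : ℕ} (c z : Fin d → ℝ) {b : ℝ} (hb : ∀ k, |c k| ≤ b) (hb0 : 0 ≤ b) :
    ‖fun k => c k * z k‖ ≤ b * ‖z‖ := by
  refine (pi_norm_le_iff_of_nonneg (by positivity)).2 fun k => ?_
  rw [norm_mul]
  exact mul_le_mul (hb k) (norm_le_pi_norm z k) (norm_nonneg _) hb0

lemma prod_abs_le_pow {d : ℕ} (v : Finset (Fin d)) (z : Fin d → ℝ) :
    ∏ k ∈ v, |z k| ≤ (1 + ‖z‖) ^ v.card := by
  rw [← Finset.prod_const]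
  refine Finset.prod_le_prod (fun _ _ => abs_nonneg _) fun k _ => ?_
  have := norm_le_pi_norm z k
  rw [Real.norm_eq_abs] at this
  linarith

lemma piecewise_zero_mul {d : ℕ} (A : Finset (Fin d)) (c z : Fin d → ℝ) :
    A.piecewise 0 (fun k => c k * z k) = fun k => c k * A.piecewise 0 z k := by
  funext k
  by_cases hk : k ∈ A <;> simp [hk]

lemma integrable_of_polynomial_growth {d : ℕ} {μ : Fin d → Measure ℝ}
    [∀ k, IsProbabilityMeasure (μ k)] (hμ : ∀ k m, Integrable (fun a => (1 + |a|) ^ m) (μ k))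
    {F : (Fin d → ℝ) → ℝ} (hF : Measurable F) {K : ℝ} {m : ℕ}
    (hK : ∀ z, |F z| ≤ K * (1 + ‖z‖) ^ m) : Integrable F (Measure.pi μ) :=
  ((integrable_one_add_norm_pow fun k => hμ k m).const_mul K).mono' hF.aestronglyMeasurable
    (Eventually.of_forall hK)

/-- In the summand of a non-empty A, a variable z_k with k ∈ A has been removed from G and survives
only as a centred factor, so the integral vanishes. Only A = ∅ contributes. -/
lemma integral_mul_prod_eq_mixedDiff {d : ℕ} {μ : Fin d → Measure ℝ}
    [∀ k, IsProbabilityMeasure (μ k)] (hμ : ∀ k m, Integrable (fun a => (1 + |a|) ^ m) (μ k))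
    (hmean : ∀ k, ∫ a, a ∂μ k = 0) {G : (Fin d → ℝ) → ℝ} (hG : Continuous G) {K : ℝ} {m : ℕ}
    (hK0 : 0 ≤ K) (hK : ∀ z, |G z| ≤ K * (1 + ‖z‖) ^ m) (v : Finset (Fin d)) (c : Fin d → ℝ) :
    ∫ z, G (fun k => c k * z k) * ∏ k ∈ v, z k ∂Measure.pi μ =
      ∫ z, mixedDiff v G (fun k => c k * z k) * ∏ k ∈ v, z k ∂Measure.pi μ := by
  have hcomp : ∀ A : Finset (Fin d),
      Continuous fun z : Fin d → ℝ => G (fun k => c k * A.piecewise 0 z k) := fun A => by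
    have h1 := continuous_piecewise_left (d := d) A 0
    exact hG.comp (continuous_pi fun k => continuous_const.mul ((continuous_apply k).comp h1))
  have hint : ∀ A : Finset (Fin d), Integrable
      (fun z : Fin d → ℝ => G (fun k => c k * A.piecewise 0 z k) * ∏ k ∈ v, z k)
      (Measure.pi μ) := by
    intro A
    refine integrable_of_polynomial_growth hμ (K := K * (1 + ‖c‖) ^ m) (m := m + v.card)
      (((hcomp A).mul (by fun_prop)).measurable) fun z => ?_
    rw [abs_mul, Finset.abs_prod, pow_add, ← mul_assoc]
    refine mul_le_mul ((hK _).trans ?_) (prod_abs_le_pow v z)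
      (Finset.prod_nonneg fun _ _ => abs_nonneg _) (by positivity)
    rw [mul_assoc, ← mul_pow]
    have h1 := norm_mul_le_of_abs_le c (A.piecewise 0 z) (b := ‖c‖)
      (fun k => norm_le_pi_norm c k) (norm_nonneg c)
    have h2 := one_add_norm_piecewise_le A 0 z
    rw [norm_zero, add_zero, one_mul] at h2
    have h3 := norm_nonneg c
    have h4 := norm_nonneg (A.piecewise 0 z)
    gcongr
    nlinarith
  unfold mixedDiff
  simp_rw [Finset.sum_mul, piecewise_zero_mul, mul_assoc]
  rw [integral_finsetSum _ fun A _ => (hint A).const_mul _]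
  simp_rw [integral_const_mul]
  rw [Finset.sum_eq_single_of_mem ∅ (Finset.empty_mem_powerset v)]
  · simp
  · intro A hA hne
    obtain ⟨k, hk⟩ := Finset.nonempty_iff_ne_empty.2 hne
    have hkv := Finset.mem_powerset.1 hA hk
    rw [integral_eq_integral_update k (hint A)]
    have hz : ∀ z : Fin d → ℝ, ∫ a, G (fun j => c j * A.piecewise 0 (Function.update z k a) j) *
        ∏ j ∈ v, Function.update z k a j ∂μ k = 0 := by
      intro z
      have h1 : ∀ a, A.piecewise 0 (Function.update z k a) = A.piecewise 0 z := by
        intro a; funext j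
        by_cases hj : j ∈ A
        · simp [hj]
        · simp [hj, (ne_of_mem_of_not_mem hk hj).symm]
      have h2 : ∀ a, ∏ j ∈ v, Function.update z k a j = a * ∏ j ∈ v.erase k, z j := by
        intro a
        rw [← Finset.mul_prod_erase _ _ hkv, Function.update_self]
        congr 1
        exact Finset.prod_congr rfl fun j hj => Function.update_of_ne (Finset.ne_of_mem_erase hj) _ _
      simp_rw [h1, h2]
      rw [integral_const_mul, integral_mul_const, hmean]
      simp
    simp [hz]

section Estimator

variable {d n : ℕ} {ν : Fin d → Measure ℝ} [∀ k, IsProbabilityMeasure (ν k)]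
  {w : Fin d → ℝ → ℝ} {x : Fin d → ℝ} {Φ : Finset (Fin d) → (Fin d → ℝ) → ℝ} {K : ℝ}
  {μ : Fin d → Measure ℝ} [∀ k, IsProbabilityMeasure (μ k)] {σ : ℝ}

/-- The mixed difference quotient of `M` at `y` in the random direction `z`, with the weight of
the expansion. -/
noncomputable def weightedQuotient (w : Fin d → ℝ → ℝ) (M : (Fin d → ℝ) → ℝ) (σ b : ℝ)
    (h : Fin d → ℝ) (v : Finset (Fin d)) (p : (Fin d → ℝ) × (Fin d → ℝ)) : ℝ :=
  (∏ k ∈ v, w k (p.1 k)) *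
    (mixedDiff v (fun z => M (p.1 + z)) (fun k => b * h k * p.2 k) *
      ∏ k ∈ v, p.2 k / (h k * σ ^ 2))

lemma measurable_weightedQuotient (hw : ∀ k, Measurable (w k)) {M : (Fin d → ℝ) → ℝ}
    (hM : Continuous M) (b : ℝ) (h : Fin d → ℝ) (v : Finset (Fin d)) :
    Measurable (weightedQuotient w M σ b h v) := by
  unfold weightedQuotient
  refine Measurable.mul (by fun_prop) (Measurable.mul ?_ (by fun_prop))
  unfold mixedDiff
  refine Finset.measurable_fun_sum _ fun A _ => measurable_const.mul (hM.measurable.comp ?_)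
  refine measurable_fst.add ?_
  exact (continuous_piecewise_left A 0).measurable.comp (by fun_prop)

/-- Each factor b h_k z_k of the mixed difference meets z_k / (h_k σ²), so the bandwidth cancels and
b z_k² / σ² remains. -/
lemma IsMixedDerivFamily.exists_weightedQuotient_eq (hΦ : IsMixedDerivFamily Φ) (b : ℝ)
    {h : Fin d → ℝ} (hpos : ∀ k, 0 < h k) (v : Finset (Fin d))
    (p : (Fin d → ℝ) × (Fin d → ℝ)) : ∃ ξ : Fin d → ℝ, ‖ξ‖ ≤ |b| * ‖h‖ * ‖p.2‖ ∧
      weightedQuotient w (Φ ∅) σ b h v p =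
        (∏ k ∈ v, w k (p.1 k)) * (b ^ v.card * (∏ k ∈ v, p.2 k ^ 2 / σ ^ 2) * Φ v (p.1 + ξ)) := by
  obtain ⟨ξ, hξ, he⟩ := (hΦ.translate p.1).exists_mixedDiff_eq v ∅ (by simp)
    (fun k => b * h k * p.2 k)
  refine ⟨ξ, ?_, ?_⟩
  · refine (pi_norm_le_iff_of_nonneg (by positivity)).2 fun j => (hξ j).trans ?_
    rw [abs_mul, abs_mul]
    gcongr
    · exact norm_le_pi_norm h j
    · exact norm_le_pi_norm p.2 j
  · rw [weightedQuotient, he, Finset.union_empty]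
    congr 1
    rw [mul_right_comm, ← Finset.prod_mul_distrib, ← Finset.prod_const, ← Finset.prod_mul_distrib]
    congr 1
    refine Finset.prod_congr rfl fun k _ => ?_
    have := (hpos k).ne'
    by_cases hσ : σ = 0
    · simp [hσ]
    · field_simp

/-- The bound sees h only through H. With H = ‖h‖ it gives integrability, with H = 1 a common
dominating function for all small bandwidths. -/
lemma abs_weightedQuotient_le (hΦ : IsMixedDerivFamily Φ) (hK : 0 ≤ K) {v : Finset (Fin d)}
    (h1 : ∀ y, |Φ v y| ≤ K * (1 + ‖y‖) ^ n) (b : ℝ) {h : Fin d → ℝ} (hpos : ∀ k, 0 < h k)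
    {H : ℝ} (hH : ‖h‖ ≤ H) (p : (Fin d → ℝ) × (Fin d → ℝ)) :
    |weightedQuotient w (Φ ∅) σ b h v p| ≤ ((1 + ‖p.1‖) ^ n * |∏ k ∈ v, w k (p.1 k)|) *
      (K * (1 + |b| * H) ^ n * |b| ^ v.card * (σ⁻¹ ^ 2) ^ v.card *
        (1 + ‖p.2‖) ^ (n + 2 * v.card)) := by
  obtain ⟨ξ, hξ, he⟩ := hΦ.exists_weightedQuotient_eq (w := w) (σ := σ) b hpos v p
  have hy := norm_nonneg p.1
  have hz := norm_nonneg p.2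
  have hH0 : 0 ≤ H := (norm_nonneg h).trans hH
  have hbH : 0 ≤ |b| * H := by positivity
  have e1 : 1 + ‖p.1 + ξ‖ ≤ (1 + ‖p.1‖) * ((1 + |b| * H) * (1 + ‖p.2‖)) := by
    have a1 := norm_add_le p.1 ξ
    have a2 : ‖ξ‖ ≤ |b| * H * ‖p.2‖ := hξ.trans (by gcongr)
    have a3 : 0 ≤ |b| * H * ‖p.2‖ := by positivity
    have a4 : 1 + |b| * H * ‖p.2‖ ≤ (1 + |b| * H) * (1 + ‖p.2‖) := by nlinarith
    nlinarith [mul_nonneg hy (sub_nonneg.2 a4), mul_nonneg hy a3]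
  have e2 : |Φ v (p.1 + ξ)| ≤
      K * ((1 + ‖p.1‖) ^ n * ((1 + |b| * H) ^ n * (1 + ‖p.2‖) ^ n)) := by
    refine (h1 _).trans ?_
    rw [← mul_pow, ← mul_pow]
    gcongr
  have e3 : |∏ k ∈ v, p.2 k ^ 2 / σ ^ 2| ≤ (σ⁻¹ ^ 2) ^ v.card * (1 + ‖p.2‖) ^ (2 * v.card) := by
    simp_rw [div_eq_mul_inv]
    rw [Finset.prod_mul_distrib, Finset.prod_const, abs_mul, mul_comm, Finset.prod_pow, abs_pow,
      abs_pow, Finset.abs_prod, abs_of_nonneg (by positivity), inv_pow, pow_mul']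
    gcongr
    · rw [inv_pow, inv_pow]
    · exact prod_abs_le_pow v p.2
  rw [he, abs_mul, abs_mul, abs_mul, abs_pow]
  calc |∏ k ∈ v, w k (p.1 k)| * (|b| ^ v.card * |∏ k ∈ v, p.2 k ^ 2 / σ ^ 2| * |Φ v (p.1 + ξ)|)
      ≤ |∏ k ∈ v, w k (p.1 k)| * (|b| ^ v.card * ((σ⁻¹ ^ 2) ^ v.card *
        (1 + ‖p.2‖) ^ (2 * v.card)) *
          (K * ((1 + ‖p.1‖) ^ n * ((1 + |b| * H) ^ n * (1 + ‖p.2‖) ^ n)))) := by gcongr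
    _ = _ := by rw [pow_add]; ring

lemma integrable_weightedQuotient (hw : ∀ k, IsExpansionWeight n (ν k) (w k) (x k))
    (hΦ : IsMixedDerivFamily Φ) (hK : 0 ≤ K) {v : Finset (Fin d)}
    (h1 : ∀ y, |Φ v y| ≤ K * (1 + ‖y‖) ^ n)
    (hμ : ∀ k m, Integrable (fun a => (1 + |a|) ^ m) (μ k)) (b : ℝ) {h : Fin d → ℝ}
    (hpos : ∀ k, 0 < h k) :
    Integrable (weightedQuotient w (Φ ∅) σ b h v) ((Measure.pi ν).prod (Measure.pi μ)) := by
  refine ((integrable_one_add_norm_pow_mul_weight hw v).mul_prod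
    ((integrable_one_add_norm_pow fun k => hμ k (n + 2 * v.card)).const_mul
      (K * (1 + |b| * ‖h‖) ^ n * |b| ^ v.card * (σ⁻¹ ^ 2) ^ v.card))).mono'
    (measurable_weightedQuotient (fun k => (hw k).measurable)
      (hΦ.continuous ∅) b h v).aestronglyMeasurable (Eventually.of_forall fun p => ?_)
  exact abs_weightedQuotient_le hΦ hK h1 b hpos le_rfl p

/-- Dominated convergence: the intermediate point ξ tends to 0 with h, and by independence ∏ z_k² /
σ² has mean 1. -/
lemma tendsto_integral_weightedQuotient (hw : ∀ k, IsExpansionWeight n (ν k) (w k) (x k))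
    (hΦ : IsMixedDerivFamily Φ) (hK : 0 ≤ K) {v : Finset (Fin d)}
    (h1 : ∀ y, |Φ v y| ≤ K * (1 + ‖y‖) ^ n)
    (hμ : ∀ k m, Integrable (fun a => (1 + |a|) ^ m) (μ k)) (hσ : σ ≠ 0)
    (hvar : ∀ k, ∫ a, a ^ 2 ∂μ k = σ ^ 2) (b : ℝ) {h : ℕ → Fin d → ℝ}
    (hpos : ∀ N k, 0 < h N k) (hlim : Tendsto h atTop (𝓝 0)) :
    Tendsto (fun N => ∫ p, weightedQuotient w (Φ ∅) σ b (h N) v p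
        ∂(Measure.pi ν).prod (Measure.pi μ)) atTop
      (𝓝 (b ^ v.card * ∫ y, Φ v y * ∏ k ∈ v, w k (y k) ∂Measure.pi ν)) := by
  have hnorm : Tendsto (fun N => ‖h N‖) atTop (𝓝 0) := by simpa using hlim.norm
  have hev : ∀ᶠ N in atTop, ‖h N‖ ≤ 1 := hnorm.eventually (eventually_le_nhds zero_lt_one)
  have hlimit : ∫ p : (Fin d → ℝ) × (Fin d → ℝ), (Φ v p.1 * ∏ k ∈ v, w k (p.1 k)) *
        (b ^ v.card * ∏ k ∈ v, p.2 k ^ 2 / σ ^ 2) ∂(Measure.pi ν).prod (Measure.pi μ) =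
      b ^ v.card * ∫ y, Φ v y * ∏ k ∈ v, w k (y k) ∂Measure.pi ν := by
    have h2 : ∫ z : Fin d → ℝ, ∏ k ∈ v, z k ^ 2 / σ ^ 2 ∂Measure.pi μ = 1 := by
      have h3 : ∀ z : Fin d → ℝ, ∏ k ∈ v, z k ^ 2 / σ ^ 2 =
          ∏ k, if k ∈ v then z k ^ 2 / σ ^ 2 else 1 := fun z => by
        rw [Finset.prod_ite_mem, Finset.univ_inter]
      simp_rw [h3]
      rw [integral_fintype_prod_eq_prod (fun k a => if k ∈ v then a ^ 2 / σ ^ 2 else 1)]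
      refine Finset.prod_eq_one fun k _ => ?_
      by_cases hk : k ∈ v
      · simp only [hk, if_true]
        rw [integral_div, hvar, div_self (pow_ne_zero 2 hσ)]
      · simp [hk]
    rw [integral_prod_mul (fun y => Φ v y * ∏ k ∈ v, w k (y k))
      (fun z : Fin d → ℝ => b ^ v.card * ∏ k ∈ v, z k ^ 2 / σ ^ 2), integral_const_mul, h2]
    ring
  rw [← hlimit]
  refine tendsto_integral_filter_of_dominated_convergence
    (fun p => ((1 + ‖p.1‖) ^ n * |∏ k ∈ v, w k (p.1 k)|) *
      (K * (1 + |b| * 1) ^ n * |b| ^ v.card * (σ⁻¹ ^ 2) ^ v.card *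
        (1 + ‖p.2‖) ^ (n + 2 * v.card)))
    (Eventually.of_forall fun N => (measurable_weightedQuotient (fun k => (hw k).measurable)
      (hΦ.continuous ∅) b (h N) v).aestronglyMeasurable) ?_
    ((integrable_one_add_norm_pow_mul_weight hw v).mul_prod
      ((integrable_one_add_norm_pow fun k => hμ k (n + 2 * v.card)).const_mul
        (K * (1 + |b| * 1) ^ n * |b| ^ v.card * (σ⁻¹ ^ 2) ^ v.card))) ?_
  · filter_upwards [hev] with N hN
    exact Eventually.of_forall fun p => abs_weightedQuotient_le hΦ hK h1 b (hpos N) hN p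
  · refine Eventually.of_forall fun p => ?_
    choose ξ hξ he using fun N =>
      hΦ.exists_weightedQuotient_eq (w := w) (σ := σ) b (hpos N) v p
    have hξ0 : Tendsto ξ atTop (𝓝 0) := by
      refine squeeze_zero_norm hξ ?_
      have := (hnorm.const_mul |b|).mul_const ‖p.2‖
      simpa using this
    have hΦlim : Tendsto (fun N => Φ v (p.1 + ξ N)) atTop (𝓝 (Φ v p.1)) := by
      have h4 : Tendsto (fun N => p.1 + ξ N) atTop (𝓝 p.1) := by
        simpa using hξ0.const_add p.1
      exact ((hΦ.continuous v).tendsto p.1).comp h4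
    simp_rw [he]
    have h5 := (hΦlim.const_mul (b ^ v.card * ∏ k ∈ v, p.2 k ^ 2 / σ ^ 2)).const_mul
      (∏ k ∈ v, w k (p.1 k))
    convert h5 using 2
    ring

/-! ### Contribution of a single perturbation: size, second moment and mean -/

variable {L : ℕ} {β c : Fin L → ℝ}

/-- The contribution of one perturbation `z` to the estimator of the `v`-th term of the
expansion. -/
noncomputable def sampleTerm (ν : Fin d → Measure ℝ) (w : Fin d → ℝ → ℝ) (M : (Fin d → ℝ) → ℝ)
    (β c : Fin L → ℝ) (σ : ℝ) (h : Fin d → ℝ) (v : Finset (Fin d)) (z : Fin d → ℝ) : ℝ :=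
  (∫ y, (∑ l, c l * M (fun k => y k + β l * h k * z k)) * ∏ k ∈ v, w k (y k) ∂Measure.pi ν) *
    ∏ k ∈ v, z k / (h k * σ ^ 2)

/-- The linear combination of values of `M` with coefficients `c` along `z`, scaled by `β`, has
order `r + 1` in `z`. -/
def StencilBound (M : (Fin d → ℝ) → ℝ) (β c : Fin L → ℝ) (n r : ℕ) (K : ℝ) : Prop :=
  ∀ y z : Fin d → ℝ, |∑ l, c l * M (fun k => y k + β l * z k)| ≤
    K * (‖z‖ ^ (r + 1) * (1 + ‖z‖) ^ n * (1 + ‖y‖) ^ n)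

lemma StencilBound.abs_le {M : (Fin d → ℝ) → ℝ} {r : ℕ} (hK : 0 ≤ K)
    (hS : StencilBound M β c n r K) (h y z : Fin d → ℝ) :
    |∑ l, c l * M (fun k => y k + β l * h k * z k)| ≤
      K * (‖h‖ ^ (r + 1) * (1 + ‖h‖) ^ n * (1 + ‖z‖) ^ (r + 1 + n)) * (1 + ‖y‖) ^ n := by
  have h1 := hS y (fun k => h k * z k)
  have h2 := norm_mul_le_of_abs_le h z (b := ‖h‖) (fun k => norm_le_pi_norm h k) (norm_nonneg h)
  have hh := norm_nonneg h
  have hz := norm_nonneg z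
  simp only [← mul_assoc (β _)] at h1
  refine h1.trans ?_
  rw [mul_assoc K]
  refine mul_le_mul_of_nonneg_left ?_ hK
  refine mul_le_mul_of_nonneg_right ?_ (by positivity)
  have h3 : 1 + ‖fun k => h k * z k‖ ≤ (1 + ‖h‖) * (1 + ‖z‖) := by nlinarith
  have h4 : ‖fun k => h k * z k‖ ≤ ‖h‖ * (1 + ‖z‖) := by nlinarith
  calc ‖fun k => h k * z k‖ ^ (r + 1) * (1 + ‖fun k => h k * z k‖) ^ n
      ≤ (‖h‖ * (1 + ‖z‖)) ^ (r + 1) * ((1 + ‖h‖) * (1 + ‖z‖)) ^ n := by gcongr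
    _ = _ := by rw [mul_pow, mul_pow, pow_add (1 + ‖z‖)]; ring

lemma StencilBound.integrable (hw : ∀ k, IsExpansionWeight n (ν k) (w k) (x k))
    {M : (Fin d → ℝ) → ℝ} (hM : Continuous M) {r : ℕ} (hK : 0 ≤ K)
    (hS : StencilBound M β c n r K) (h z : Fin d → ℝ) (v : Finset (Fin d)) :
    Integrable (fun y => (∑ l, c l * M (fun k => y k + β l * h k * z k)) *
      ∏ k ∈ v, w k (y k)) (Measure.pi ν) :=
  integrable_mul_weight hw (Continuous.measurable (by fun_prop)) v fun y => hS.abs_le hK h y z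

lemma measurable_stencil {M : (Fin d → ℝ) → ℝ} (hM : Continuous M) (h : Fin d → ℝ) :
    Measurable fun p : (Fin d → ℝ) × (Fin d → ℝ) =>
      ∑ l, c l * M (fun k => p.1 k + β l * h k * p.2 k) :=
  Continuous.measurable (by fun_prop)

lemma measurable_sampleTerm (hw : ∀ k, Measurable (w k)) {M : (Fin d → ℝ) → ℝ}
    (hM : Continuous M) (h : Fin d → ℝ) (v : Finset (Fin d)) :
    Measurable (sampleTerm ν w M β c σ h v) := by
  unfold sampleTerm
  refine Measurable.mul ?_ (by fun_prop)
  refine (StronglyMeasurable.integral_prod_left (f := fun y z : Fin d → ℝ =>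
    (∑ l, c l * M (fun k => y k + β l * h k * z k)) * ∏ k ∈ v, w k (y k)) ?_).measurable
  exact ((measurable_stencil hM h).mul (by fun_prop)).stronglyMeasurable

lemma abs_prod_div_le {h : Fin d → ℝ} (hpos : ∀ k, 0 < h k) (v : Finset (Fin d)) (z : Fin d → ℝ) :
    |∏ k ∈ v, z k / (h k * σ ^ 2)| ≤
      (σ⁻¹ ^ 2) ^ v.card / (∏ k ∈ v, h k) * (1 + ‖z‖) ^ v.card := by
  have h0 : 0 < ∏ k ∈ v, h k := Finset.prod_pos fun k _ => hpos k
  rw [Finset.prod_div_distrib, Finset.prod_mul_distrib, Finset.prod_const, abs_div, abs_mul,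
    abs_of_pos h0, abs_of_nonneg (by positivity : (0 : ℝ) ≤ (σ ^ 2) ^ v.card), Finset.abs_prod]
  calc (∏ k ∈ v, |z k|) / ((∏ k ∈ v, h k) * (σ ^ 2) ^ v.card)
      ≤ (1 + ‖z‖) ^ v.card / ((∏ k ∈ v, h k) * (σ ^ 2) ^ v.card) := by
        gcongr; exact prod_abs_le_pow v z
    _ = _ := by rw [inv_pow, inv_pow, div_mul_eq_div_div, div_eq_mul_inv _ ((σ ^ 2) ^ v.card)]; ring

/-- The numerator ‖h‖^(r+1) comes from the cancelled Taylor orders, the denominator ∏ h_k from the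
difference quotient; squared and divided by N, their ratio is the quantity assumed to vanish. -/
lemma abs_sampleTerm_le (hw : ∀ k, IsExpansionWeight n (ν k) (w k) (x k))
    {M : (Fin d → ℝ) → ℝ} {r : ℕ} (hK : 0 ≤ K)
    (hS : StencilBound M β c n r K) {h : Fin d → ℝ} (hpos : ∀ k, 0 < h k) (v : Finset (Fin d))
    (z : Fin d → ℝ) :
    |sampleTerm ν w M β c σ h v z| ≤
      (K * (σ⁻¹ ^ 2) ^ v.card * ∫ y, (1 + ‖y‖) ^ n * |∏ k ∈ v, w k (y k)| ∂Measure.pi ν) *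
        (1 + ‖h‖) ^ n * (‖h‖ ^ (r + 1) / ∏ k ∈ v, h k) * (1 + ‖z‖) ^ (r + 1 + n + v.card) := by
  have h0 : 0 < ∏ k ∈ v, h k := Finset.prod_pos fun k _ => hpos k
  have hI := integrable_one_add_norm_pow_mul_weight hw v
  have h1 : |∫ y, (∑ l, c l * M (fun k => y k + β l * h k * z k)) *
      ∏ k ∈ v, w k (y k) ∂Measure.pi ν| ≤
      K * (‖h‖ ^ (r + 1) * (1 + ‖h‖) ^ n * (1 + ‖z‖) ^ (r + 1 + n)) *
        ∫ y, (1 + ‖y‖) ^ n * |∏ k ∈ v, w k (y k)| ∂Measure.pi ν := by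
    rw [← integral_const_mul, ← Real.norm_eq_abs (∫ y, _ ∂Measure.pi ν)]
    refine norm_integral_le_of_norm_le (hI.const_mul _) (Eventually.of_forall fun y => ?_)
    rw [norm_mul, Real.norm_eq_abs, Real.norm_eq_abs, ← mul_assoc]
    exact mul_le_mul_of_nonneg_right (hS.abs_le hK h y z) (abs_nonneg _)
  have hI0 : 0 ≤ ∫ y, (1 + ‖y‖) ^ n * |∏ k ∈ v, w k (y k)| ∂Measure.pi ν :=
    integral_nonneg fun y => by positivity
  rw [sampleTerm, abs_mul]
  calc _ ≤ (K * (‖h‖ ^ (r + 1) * (1 + ‖h‖) ^ n * (1 + ‖z‖) ^ (r + 1 + n)) *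
        ∫ y, (1 + ‖y‖) ^ n * |∏ k ∈ v, w k (y k)| ∂Measure.pi ν) *
        ((σ⁻¹ ^ 2) ^ v.card / (∏ k ∈ v, h k) * (1 + ‖z‖) ^ v.card) :=
        mul_le_mul h1 (abs_prod_div_le hpos v z) (abs_nonneg _) (by positivity)
    _ = _ := by rw [pow_add (1 + ‖z‖) (r + 1 + n)]; ring

lemma memLp_sampleTerm (hw : ∀ k, IsExpansionWeight n (ν k) (w k) (x k))
    {M : (Fin d → ℝ) → ℝ} (hM : Continuous M) {r : ℕ} (hK : 0 ≤ K)
    (hS : StencilBound M β c n r K) (hμ : ∀ k m, Integrable (fun a => (1 + |a|) ^ m) (μ k))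
    {h : Fin d → ℝ} (hpos : ∀ k, 0 < h k) (v : Finset (Fin d)) :
    MemLp (sampleTerm ν w M β c σ h v) 2 (Measure.pi μ) := by
  have hm := measurable_sampleTerm (ν := ν) (σ := σ) (β := β) (c := c)
    (fun k => (hw k).measurable) hM h v
  refine (memLp_two_iff_integrable_sq hm.aestronglyMeasurable).2 ?_
  refine integrable_of_polynomial_growth hμ (hm.pow_const 2)
    (K := ((K * (σ⁻¹ ^ 2) ^ v.card *
      ∫ y, (1 + ‖y‖) ^ n * |∏ k ∈ v, w k (y k)| ∂Measure.pi ν) *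
        (1 + ‖h‖) ^ n * (‖h‖ ^ (r + 1) / ∏ k ∈ v, h k)) ^ 2) (m := (r + 1 + n + v.card) * 2)
    fun z => ?_
  rw [abs_pow, pow_mul, ← mul_pow]
  exact pow_le_pow_left₀ (abs_nonneg _) (abs_sampleTerm_le hw hK hS hpos v z) 2

lemma integral_sampleTerm_sq_le (hw : ∀ k, IsExpansionWeight n (ν k) (w k) (x k))
    {M : (Fin d → ℝ) → ℝ} {r : ℕ} (hK : 0 ≤ K)
    (hS : StencilBound M β c n r K) (hμ : ∀ k m, Integrable (fun a => (1 + |a|) ^ m) (μ k))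
    (v : Finset (Fin d)) :
    ∃ B, 0 ≤ B ∧ ∀ h : Fin d → ℝ, (∀ k, 0 < h k) → ‖h‖ ≤ 1 →
      ∫ z, sampleTerm ν w M β c σ h v z ^ 2 ∂Measure.pi μ ≤
        B * (‖h‖ ^ (2 * (r + 1)) / ∏ k ∈ v, h k ^ 2) := by
  obtain ⟨A, hA⟩ : ∃ A, A = K * (σ⁻¹ ^ 2) ^ v.card *
    ∫ y, (1 + ‖y‖) ^ n * |∏ k ∈ v, w k (y k)| ∂Measure.pi ν := ⟨_, rfl⟩
  have hA0 : 0 ≤ A := hA ▸ mul_nonneg (by positivity) (integral_nonneg fun y => by positivity)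
  have hi := integrable_one_add_norm_pow fun k => hμ k ((r + 1 + n + v.card) * 2)
  refine ⟨(A * 2 ^ n) ^ 2 * ∫ z, (1 + ‖z‖) ^ ((r + 1 + n + v.card) * 2) ∂Measure.pi μ,
    mul_nonneg (by positivity) (integral_nonneg fun z => by positivity), fun h hpos hh => ?_⟩
  have h0 : 0 < ∏ k ∈ v, h k := Finset.prod_pos fun k _ => hpos k
  have hle : ∀ z, sampleTerm ν w M β c σ h v z ^ 2 ≤
      ((A * 2 ^ n) ^ 2 * (‖h‖ ^ (2 * (r + 1)) / ∏ k ∈ v, h k ^ 2)) *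
        (1 + ‖z‖) ^ ((r + 1 + n + v.card) * 2) := by
    intro z
    have h1 := abs_sampleTerm_le (σ := σ) hw hK hS hpos v z
    rw [← hA] at h1
    calc sampleTerm ν w M β c σ h v z ^ 2 = |sampleTerm ν w M β c σ h v z| ^ 2 := (sq_abs _).symm
      _ ≤ (A * 2 ^ n * (‖h‖ ^ (r + 1) / ∏ k ∈ v, h k) *
            (1 + ‖z‖) ^ (r + 1 + n + v.card)) ^ 2 := by
          refine pow_le_pow_left₀ (abs_nonneg _) (h1.trans ?_) 2
          gcongr
          linarith
      _ = _ := by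
          rw [mul_pow, mul_pow, div_pow, ← pow_mul, ← pow_mul, Finset.prod_pow,
            mul_comm (r + 1) 2]
  calc _ ≤ ∫ z, ((A * 2 ^ n) ^ 2 * (‖h‖ ^ (2 * (r + 1)) / ∏ k ∈ v, h k ^ 2)) *
        (1 + ‖z‖) ^ ((r + 1 + n + v.card) * 2) ∂Measure.pi μ :=
        integral_mono_of_nonneg (Eventually.of_forall fun z => sq_nonneg _) (hi.const_mul _)
          (Eventually.of_forall hle)
    _ = _ := by rw [integral_const_mul]; ring

/-- Fubini is applied to the whole linear combination, whose cancellation lowers the growth in y to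
n. A single value of M may grow like n + 1, which the weights are not known to integrate, so the sum
over l is split only once y is fixed. There each value is replaced by its mixed difference, and
these are again jointly integrable. -/
lemma integral_sampleTerm (hw : ∀ k, IsExpansionWeight n (ν k) (w k) (x k))
    (hΦ : IsMixedDerivFamily Φ) (hK : 0 ≤ K) (h0 : ∀ y, |Φ ∅ y| ≤ K * (1 + ‖y‖) ^ (n + 1))
    {v : Finset (Fin d)} (h1 : ∀ y, |Φ v y| ≤ K * (1 + ‖y‖) ^ n) {r : ℕ} {K' : ℝ} (hK' : 0 ≤ K')
    (hS : StencilBound (Φ ∅) β c n r K')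
    (hμ : ∀ k m, Integrable (fun a => (1 + |a|) ^ m) (μ k))
    (hmean : ∀ k, ∫ a, a ∂μ k = 0) {h : Fin d → ℝ} (hpos : ∀ k, 0 < h k) :
    ∫ z, sampleTerm ν w (Φ ∅) β c σ h v z ∂Measure.pi μ =
      ∑ l, c l * ∫ p, weightedQuotient w (Φ ∅) σ (β l) h v p
        ∂(Measure.pi ν).prod (Measure.pi μ) := by
  have hM := hΦ.continuous ∅
  have hwm : ∀ k, Measurable (w k) := fun k => (hw k).measurable
  have hjoint : Integrable (fun p : (Fin d → ℝ) × (Fin d → ℝ) =>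
      (∑ l, c l * Φ ∅ (fun k => p.1 k + β l * h k * p.2 k)) * (∏ k ∈ v, w k (p.1 k)) *
        ∏ k ∈ v, p.2 k / (h k * σ ^ 2)) ((Measure.pi ν).prod (Measure.pi μ)) := by
    have hp0 : 0 < ∏ k ∈ v, h k := Finset.prod_pos fun k _ => hpos k
    refine ((integrable_one_add_norm_pow_mul_weight hw v).mul_prod
      ((integrable_one_add_norm_pow fun k => hμ k (r + 1 + n + v.card)).const_mul
        (K' * (‖h‖ ^ (r + 1) * (1 + ‖h‖) ^ n) * ((σ⁻¹ ^ 2) ^ v.card / ∏ k ∈ v, h k)))).mono'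
      (((measurable_stencil hM h).mul (by fun_prop)).mul (by fun_prop)).aestronglyMeasurable
      (Eventually.of_forall fun p => ?_)
    rw [norm_mul, norm_mul, Real.norm_eq_abs, Real.norm_eq_abs, Real.norm_eq_abs]
    calc _ ≤ (K' * (‖h‖ ^ (r + 1) * (1 + ‖h‖) ^ n * (1 + ‖p.2‖) ^ (r + 1 + n)) *
          (1 + ‖p.1‖) ^ n) * |∏ k ∈ v, w k (p.1 k)| *
          ((σ⁻¹ ^ 2) ^ v.card / (∏ k ∈ v, h k) * (1 + ‖p.2‖) ^ v.card) := by
          gcongr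
          · exact hS.abs_le hK' h p.1 p.2
          · exact abs_prod_div_le hpos v p.2
      _ = _ := by rw [pow_add (1 + ‖p.2‖) (r + 1 + n)]; ring
  have hswap := integral_integral_swap (f := fun y z : Fin d → ℝ =>
      (∑ l, c l * Φ ∅ (fun k => y k + β l * h k * z k)) * (∏ k ∈ v, w k (y k)) *
        ∏ k ∈ v, z k / (h k * σ ^ 2)) hjoint
  have hq := fun l => integrable_weightedQuotient (σ := σ) hw hΦ hK h1 hμ (β l) hpos
  have hst : ∀ z, sampleTerm ν w (Φ ∅) β c σ h v z = ∫ y, (∑ l, c l *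
      Φ ∅ (fun k => y k + β l * h k * z k)) * (∏ k ∈ v, w k (y k)) *
        ∏ k ∈ v, z k / (h k * σ ^ 2) ∂Measure.pi ν := fun z => (integral_mul_const _ _).symm
  simp_rw [hst]
  rw [← hswap]
  simp_rw [← integral_const_mul]
  rw [← integral_finsetSum _ fun l _ => (hq l).const_mul (c l),
    integral_prod _ (integrable_finsetSum _ fun l _ => (hq l).const_mul (c l))]
  refine integral_congr_ae ?_
  have hae : ∀ᵐ y ∂Measure.pi ν, ∀ l, Integrable
      (fun z => weightedQuotient w (Φ ∅) σ (β l) h v (y, z)) (Measure.pi μ) :=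
    ae_all_iff.2 fun l => (hq l).prod_right_ae
  filter_upwards [hae] with y hy
  have hg : ∀ z, |Φ ∅ (y + z)| ≤ K * (1 + ‖y‖) ^ (n + 1) * (1 + ‖z‖) ^ (n + 1) := by
    intro z
    refine (h0 _).trans ?_
    rw [mul_assoc, ← mul_pow]
    have := norm_add_le y z
    have hyz := mul_nonneg (norm_nonneg y) (norm_nonneg z)
    gcongr
    nlinarith
  have hterm : ∀ l, ∫ z, weightedQuotient w (Φ ∅) σ (β l) h v (y, z) ∂Measure.pi μ =
      ∫ z, Φ ∅ (fun k => y k + β l * h k * z k) * (∏ k ∈ v, w k (y k)) *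
        ∏ k ∈ v, z k / (h k * σ ^ 2) ∂Measure.pi μ := by
    intro l
    have h2 := integral_mul_prod_eq_mixedDiff hμ hmean (G := fun z => Φ ∅ (y + z))
      (hM.comp (continuous_const.add continuous_id)) (by positivity) hg v (fun k => β l * h k)
    have h3 : ∀ z : Fin d → ℝ, ∏ k ∈ v, z k / (h k * σ ^ 2) =
        (∏ k ∈ v, z k) * (∏ k ∈ v, (h k * σ ^ 2))⁻¹ := fun z => by
      rw [Finset.prod_div_distrib, div_eq_mul_inv]
    have h4 : ∀ z : Fin d → ℝ, (y + fun k => β l * h k * z k) =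
        fun k => y k + β l * h k * z k := fun z => rfl
    simp only [weightedQuotient, h3]
    calc _ = (∏ k ∈ v, w k (y k)) * ((∫ z, mixedDiff v (fun z => Φ ∅ (y + z))
          (fun k => β l * h k * z k) * ∏ k ∈ v, z k ∂Measure.pi μ) *
          (∏ k ∈ v, (h k * σ ^ 2))⁻¹) := by
          rw [← integral_mul_const, ← integral_const_mul]
          simp only [mul_assoc]
      _ = _ := by
          rw [← h2, ← integral_mul_const, ← integral_const_mul]
          refine integral_congr_ae (Eventually.of_forall fun z => ?_)
          simp only [h4]
          ring
  have hdirect : ∀ l, Integrable (fun z : Fin d → ℝ =>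
      Φ ∅ (fun k => y k + β l * h k * z k) * (∏ k ∈ v, w k (y k)) *
        ∏ k ∈ v, z k / (h k * σ ^ 2)) (Measure.pi μ) := by
    intro l
    have hp0 : 0 < ∏ k ∈ v, h k := Finset.prod_pos fun k _ => hpos k
    refine integrable_of_polynomial_growth hμ (Measurable.mul
      (Continuous.measurable (by fun_prop)) (by fun_prop))
      (K := K * (1 + ‖y‖) ^ (n + 1) * (1 + |β l| * ‖h‖) ^ (n + 1) * |∏ k ∈ v, w k (y k)| *
        ((σ⁻¹ ^ 2) ^ v.card / ∏ k ∈ v, h k)) (m := n + 1 + v.card) fun z => ?_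
    rw [abs_mul, abs_mul]
    have h5 := norm_mul_le_of_abs_le (fun k => β l * h k) z (b := |β l| * ‖h‖)
      (fun k => by rw [abs_mul]; gcongr; exact norm_le_pi_norm h k) (by positivity)
    have h6 : 1 + ‖fun k => β l * h k * z k‖ ≤ (1 + |β l| * ‖h‖) * (1 + ‖z‖) := by
      have : 0 ≤ |β l| * ‖h‖ := by positivity
      nlinarith [norm_nonneg z]
    calc _ ≤ (K * (1 + ‖y‖) ^ (n + 1) * ((1 + |β l| * ‖h‖) * (1 + ‖z‖)) ^ (n + 1)) *
          |∏ k ∈ v, w k (y k)| *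
          ((σ⁻¹ ^ 2) ^ v.card / (∏ k ∈ v, h k) * (1 + ‖z‖) ^ v.card) := by
          gcongr
          · refine (hg (fun k => β l * h k * z k)).trans ?_
            gcongr
          · exact abs_prod_div_le hpos v z
      _ = _ := by rw [mul_pow (1 + |β l| * ‖h‖), pow_add (1 + ‖z‖) (n + 1)]; ring
  rw [integral_finsetSum _ fun l _ => (hy l).const_mul (c l)]
  simp_rw [integral_const_mul, hterm]
  simp_rw [← integral_const_mul]
  rw [← integral_finsetSum _ fun l _ => (hdirect l).const_mul (c l)]
  refine integral_congr_ae (Eventually.of_forall fun z => ?_)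
  simp only [Finset.sum_mul]
  exact Finset.sum_congr rfl fun l _ => by ring

lemma tendsto_integral_sampleTerm (hw : ∀ k, IsExpansionWeight n (ν k) (w k) (x k))
    (hΦ : IsMixedDerivFamily Φ) (hK : 0 ≤ K) (h0 : ∀ y, |Φ ∅ y| ≤ K * (1 + ‖y‖) ^ (n + 1))
    {v : Finset (Fin d)} (h1 : ∀ y, |Φ v y| ≤ K * (1 + ‖y‖) ^ n) {r : ℕ} {K' : ℝ} (hK' : 0 ≤ K')
    (hS : StencilBound (Φ ∅) β c n r K')
    (hμ : ∀ k m, Integrable (fun a => (1 + |a|) ^ m) (μ k)) (hσ : σ ≠ 0)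
    (hmean : ∀ k, ∫ a, a ∂μ k = 0) (hvar : ∀ k, ∫ a, a ^ 2 ∂μ k = σ ^ 2)
    (hc : ∑ l, c l * β l ^ v.card = 1) {h : ℕ → Fin d → ℝ}
    (hpos : ∀ N k, 0 < h N k) (hlim : Tendsto h atTop (𝓝 0)) :
    Tendsto (fun N => ∫ z, sampleTerm ν w (Φ ∅) β c σ (h N) v z ∂Measure.pi μ) atTop
      (𝓝 (∫ y, Φ v y * ∏ k ∈ v, w k (y k) ∂Measure.pi ν)) := by
  simp_rw [fun N => integral_sampleTerm (σ := σ) hw hΦ hK h0 h1 hK' hS hμ hmean (hpos N)]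
  have h2 := tendsto_finsetSum Finset.univ fun l _ =>
    (tendsto_integral_weightedQuotient hw hΦ hK h1 hμ hσ hvar (β l) hpos hlim).const_mul (c l)
  convert h2 using 2
  simp_rw [← mul_assoc]
  rw [← Finset.sum_mul, hc, one_mul]

end Estimator

/-! ### A weak law for triangular arrays -/

/-- Pairwise independence makes the variances add up, and a variance is at most the second moment.
At N = 0 both sides are 0. -/
lemma variance_average_le {S E : Type*} [MeasurableSpace S] [MeasurableSpace E] {P : Measure S}
    [IsProbabilityMeasure P] {π : Measure E} [IsProbabilityMeasure π] {V : ℕ → S → E}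
    (hVm : ∀ i, Measurable (V i)) (hlaw : ∀ i, P.map (V i) = π)
    (hind : Pairwise fun i j => IndepFun (V i) (V j) P) {ψ : E → ℝ} (hψ : Measurable ψ)
    (hψ2 : MemLp ψ 2 π) (N : ℕ) :
    MemLp (fun s => 1 / (N : ℝ) * ∑ i ∈ Finset.range N, ψ (V i s)) 2 P ∧
      Var[fun s => 1 / (N : ℝ) * ∑ i ∈ Finset.range N, ψ (V i s); P] ≤ (∫ z, ψ z ^ 2 ∂π) / N := by
  have hmp : ∀ i, MeasurePreserving (V i) P π := fun i => ⟨hVm i, hlaw i⟩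
  have hL : ∀ i, MemLp (fun s => ψ (V i s)) 2 P := fun i => hψ2.comp_measurePreserving (hmp i)
  have hvi : ∀ i, Var[fun s => ψ (V i s); P] = Var[ψ; π] := fun i => by
    have := variance_map (μ := P) (X := ψ) (Y := V i) (by rw [hlaw]; exact hψ.aemeasurable)
      (hVm i).aemeasurable
    rw [hlaw] at this
    exact this.symm
  refine ⟨(memLp_finsetSum _ fun i _ => hL i).const_mul _, ?_⟩
  rw [variance_const_mul]
  have hsum := IndepFun.variance_sum (μ := P) (X := fun i s => ψ (V i s)) (s := Finset.range N)
    (fun i _ => hL i) (fun i _ j _ hij => (hind hij).comp hψ hψ)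
  have hfun : (∑ i ∈ Finset.range N, fun s => ψ (V i s)) =
      fun s => ∑ i ∈ Finset.range N, ψ (V i s) := by
    funext s; simp
  rw [hfun] at hsum
  rw [hsum]
  simp only [hvi, Finset.sum_const, Finset.card_range, nsmul_eq_mul]
  have hle : Var[ψ; π] ≤ ∫ z, ψ z ^ 2 ∂π :=
    variance_le_expectation_sq hψ.aestronglyMeasurable
  rcases Nat.eq_zero_or_pos N with rfl | hN
  · simp
  · have hN' : (0 : ℝ) < N := by exact_mod_cast hN
    calc (1 / (N : ℝ)) ^ 2 * (N * Var[ψ; π]) = Var[ψ; π] / N := by field_simp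
      _ ≤ _ := by gcongr

/-- Half of ε absorbs the bias of the mean; the other half is Chebyshev's inequality. The summand ψ
N may change with N, as only E[ψ_N²]/N → 0 is needed. -/
lemma tendstoInMeasure_average {S E : Type*} [MeasurableSpace S] [MeasurableSpace E]
    {P : Measure S} [IsProbabilityMeasure P] {π : Measure E} [IsProbabilityMeasure π]
    {V : ℕ → S → E} (hVm : ∀ i, Measurable (V i)) (hlaw : ∀ i, P.map (V i) = π)
    (hind : Pairwise fun i j => IndepFun (V i) (V j) P) {ψ : ℕ → E → ℝ}
    (hψ : ∀ N, Measurable (ψ N)) (hψ2 : ∀ N, MemLp (ψ N) 2 π) {m : ℝ}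
    (hmean : Tendsto (fun N => ∫ z, ψ N z ∂π) atTop (𝓝 m))
    (hsq : Tendsto (fun N : ℕ => (∫ z, ψ N z ^ 2 ∂π) / (N : ℝ)) atTop (𝓝 0)) :
    TendstoInMeasure P
      (fun (N : ℕ) s => 1 / (N : ℝ) * ∑ i ∈ Finset.range N, ψ N (V i s)) atTop (fun _ => m) := by
  rw [tendstoInMeasure_iff_norm]
  intro ε hε
  have hev : ∀ᶠ N in atTop, |∫ z, ψ N z ∂π - m| < ε / 2 := by
    have := (Metric.tendsto_nhds.1 hmean) (ε / 2) (by positivity)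
    simpa only [Real.dist_eq] using this
  have hbound : Tendsto (fun N : ℕ => ENNReal.ofReal ((∫ z, ψ N z ^ 2 ∂π) / (N : ℝ) / (ε / 2) ^ 2))
      atTop (𝓝 0) := by
    have := ENNReal.tendsto_ofReal (hsq.div_const ((ε / 2) ^ 2))
    simpa using this
  refine tendsto_of_tendsto_of_tendsto_of_le_of_le' tendsto_const_nhds hbound
    (Eventually.of_forall fun _ => zero_le) ?_
  filter_upwards [hev, eventually_ge_atTop 1] with N hN hN1
  obtain ⟨hL, hV⟩ := variance_average_le hVm hlaw hind (hψ N) (hψ2 N) N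
  have hE : ∫ s, 1 / (N : ℝ) * ∑ i ∈ Finset.range N, ψ N (V i s) ∂P = ∫ z, ψ N z ∂π := by
    have hi : ∀ i, ∫ s, ψ N (V i s) ∂P = ∫ z, ψ N z ∂π := fun i => by
      rw [← hlaw i, integral_map (hVm i).aemeasurable (hψ N).aestronglyMeasurable]
    have hint : ∀ i, Integrable (fun s => ψ N (V i s)) P := fun i =>
      ((hψ2 N).comp_measurePreserving ⟨hVm i, hlaw i⟩).integrable one_le_two
    rw [integral_const_mul, integral_finsetSum _ fun i _ => hint i]
    simp only [hi, Finset.sum_const, Finset.card_range, nsmul_eq_mul]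
    have : (N : ℝ) ≠ 0 := by positivity
    field_simp
  refine (measure_mono fun s hs => ?_).trans
    ((meas_ge_le_variance_div_sq hL (c := ε / 2) (by positivity)).trans
      (ENNReal.ofReal_le_ofReal (by gcongr)))
  rw [Set.mem_ofPred_eq, Real.norm_eq_abs] at hs
  rw [Set.mem_ofPred_eq, hE]
  have := abs_sub_le (1 / (N : ℝ) * ∑ i ∈ Finset.range N, ψ N (V i s)) (∫ z, ψ N z ∂π) m
  linarith

/-! ### Laws of the inputs and of the perturbations -/

lemma one_add_pow_le {t : ℝ} (ht : 0 ≤ t) {m q : ℕ} (hq : m ≤ q) :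
    (1 + t) ^ m ≤ 2 ^ m * (1 + t ^ q) := by
  rcases le_total t 1 with h | h
  · calc (1 + t) ^ m ≤ 2 ^ m := pow_le_pow_left₀ (by positivity) (by linarith) m
      _ ≤ 2 ^ m * (1 + t ^ q) := le_mul_of_one_le_right (by positivity)
          (by linarith [pow_nonneg ht q])
  · calc (1 + t) ^ m ≤ (2 * t) ^ m := pow_le_pow_left₀ (by positivity) (by linarith) m
      _ = 2 ^ m * t ^ m := mul_pow _ _ _
      _ ≤ 2 ^ m * (1 + t ^ q) := by
          gcongr
          linarith [pow_le_pow_right₀ h hq]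

namespace IsPerturbationSample

variable {d : ℕ} {S : Type*} [MeasurableSpace S] {P : Measure S}
  {V : ℕ → S → Fin d → ℝ} {σ : ℝ}

lemma measurable_vector (hV : IsPerturbationSample P V σ) (i : ℕ) : Measurable (V i) :=
  measurable_pi_iff.2 (hV.measurable i)

lemma map_eq_pi [IsProbabilityMeasure P] (hV : IsPerturbationSample P V σ) (i : ℕ) :
    P.map (V i) = Measure.pi fun k => P.map fun s => V 0 s k := by
  have h1 : iIndepFun (fun k s => V i s k) P :=
    hV.indep.precomp (g := fun k : Fin d => (i, k)) fun a b h => (Prod.ext_iff.1 h).2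
  have h2 := (iIndepFun_iff_map_fun_eq_pi_map fun k => (hV.measurable i k).aemeasurable).1 h1
  simp only [(hV.identDistrib i _).map_eq] at h2
  exact h2

/-- Distinct vectors are functions of disjoint blocks of the jointly independent scalar family. -/
lemma indepFun (hV : IsPerturbationSample P V σ) :
    Pairwise fun i j => IndepFun (V i) (V j) P := by
  intro i j hij
  let block : ℕ → Finset (ℕ × Fin d) := fun i => {i} ×ˢ Finset.univ
  have hmem : ∀ i k, (i, k) ∈ block i := fun i k => by simp [block]
  have hdisj : Disjoint (block i) (block j) := by
    refine Finset.disjoint_left.2 fun p hp hp' => hij ?_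
    simp only [block, Finset.mem_product, Finset.mem_singleton, Finset.mem_univ, and_true] at hp hp'
    exact hp.symm.trans hp'
  have h := hV.indep.indepFun_finset (block i) (block j) hdisj fun p => hV.measurable p.1 p.2
  exact h.comp (φ := fun g k => g ⟨(i, k), hmem i k⟩) (ψ := fun g k => g ⟨(j, k), hmem j k⟩)
    (by fun_prop) (by fun_prop)

lemma integrable_one_add_abs_pow [IsProbabilityMeasure P]
    (hV : IsPerturbationSample P V σ) (k : Fin d) (m : ℕ) :
    Integrable (fun a => (1 + |a|) ^ m) (P.map fun s => V 0 s k) := by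
  rw [integrable_map_measure (by fun_prop) (hV.measurable 0 k).aemeasurable]
  -- The moment 2(m + 1) rather than 2m keeps the index at least 1 when m = 0.
  refine (((integrable_const (1 : ℝ)).add (hV.even_moment k (m + 1) (by omega))).const_mul
    (2 ^ m)).mono' ?_ (Eventually.of_forall fun s => ?_)
  · have := hV.measurable 0 k
    exact Measurable.aestronglyMeasurable (by fun_prop)
  · simp only [Function.comp_apply, Pi.add_apply]
    rw [Real.norm_of_nonneg (by positivity)]
    have := one_add_pow_le (abs_nonneg (V 0 s k)) (show m ≤ 2 * (m + 1) by omega)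
    rwa [pow_mul, sq_abs, ← pow_mul] at this

end IsPerturbationSample

namespace IsIndepInput

variable {d : ℕ} {T : Type*} [MeasurableSpace T] {Q : Measure T}
  {X : T → Fin d → ℝ} {g : Fin d → ℝ → ℝ} {Ω : Set (Fin d → ℝ)}

lemma measurable_vector (hX : IsIndepInput Q X g Ω) : Measurable X :=
  measurable_pi_iff.2 hX.measurable

lemma map_eq_pi [IsProbabilityMeasure Q] (hX : IsIndepInput Q X g Ω) :
    Q.map X = Measure.pi fun k => Q.map fun t => X t k :=
  (iIndepFun_iff_map_fun_eq_pi_map fun k => (hX.measurable k).aemeasurable).1 hX.indep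

/-- The projection of Ω to axis k is an interval that contains x_k, almost surely contains X_k, and
carries a positive density. A zero a of the density lies outside, so the whole interval is on one
side of a: the distribution function is 0 if a < x_k and 1 if a > x_k. -/
lemma cdf_eq_indicator [IsProbabilityMeasure Q] (hX : IsIndepInput Q X g Ω) (hΩ : IsPreconnected Ω) {x : Fin d → ℝ}
    (hx : x ∈ Ω) (k : Fin d) {a : ℝ} (ha : g k a = 0) :
    cdf (Q.map fun t => X t k) a = Set.indicator (Set.Ici (x k)) 1 a := by
  have : IsProbabilityMeasure (Q.map fun t => X t k) :=
    Measure.isProbabilityMeasure_map (hX.measurable k).aemeasurable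
  let I : Set ℝ := (fun y : Fin d → ℝ => y k) '' Ω
  have hI : I.OrdConnected := (hΩ.image _ (continuous_apply k).continuousOn).ordConnected
  have haI : a ∉ I := by
    rintro ⟨y, hy, rfl⟩
    exact (hX.density_pos y hy k).ne' ha
  have hxI : x k ∈ I := ⟨x, hx, rfl⟩
  rw [cdf_eq_real, map_measureReal_apply (hX.measurable k) measurableSet_Iic]
  rcases lt_trichotomy a (x k) with h | h | h
  · rw [Set.indicator_of_notMem (by simpa using h)]
    refine measureReal_eq_zero_iff (by simp) |>.2 ?_
    refine measure_eq_zero_iff_ae_notMem.2 ?_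
    filter_upwards [hX.mem_ae] with t ht hta
    exact haI (hI.out ⟨X t, ht, rfl⟩ hxI ⟨hta, h.le⟩)
  · exact absurd (h ▸ hxI) haI
  · rw [Set.indicator_of_mem (by simpa using h.le), Pi.one_apply]
    refine (measureReal_congr (eventuallyEq_univ.2 ?_)).trans probReal_univ
    filter_upwards [hX.mem_ae] with t ht
    by_contra hta
    have hta' : a < X t k := not_le.1 hta
    exact haI (hI.out hxI ⟨X t, ht, rfl⟩ ⟨h.le, hta'.le⟩)

lemma isExpansionWeight [IsProbabilityMeasure Q] (hX : IsIndepInput Q X g Ω) (hΩ : IsPreconnected Ω) {x : Fin d → ℝ}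
    (hx : x ∈ Ω) {n : ℕ} (hint : Integrable (fun t => euclNorm (X t) ^ (n + 1)) Q) (k : Fin d) :
    IsExpansionWeight n (Q.map fun t => X t k)
      (fun a => (inputCDF Q X k a - Set.indicator (Set.Ici (x k)) 1 a) / g k a) (x k) := by
  have : IsProbabilityMeasure (Q.map fun t => X t k) :=
    Measure.isProbabilityMeasure_map (hX.measurable k).aemeasurable
  refine isExpansionWeight_of_density ?_ (hX.measurable_density k) (hX.density_nonneg k)
    (hX.law k) fun a ha => hX.cdf_eq_indicator hΩ hx k ha
  rw [integrable_map_measure (by fun_prop) (hX.measurable k).aemeasurable]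
  refine (((integrable_const (1 : ℝ)).add hint).const_mul (2 ^ (n + 1))).mono' ?_
    (Eventually.of_forall fun t => ?_)
  · have := hX.measurable k
    exact Measurable.aestronglyMeasurable (by fun_prop)
  · simp only [Function.comp_apply, Pi.add_apply]
    rw [Real.norm_of_nonneg (by positivity)]
    refine (pow_le_pow_left₀ (by positivity) ?_ _).trans
      (one_add_pow_le (euclNorm_nonneg (X t)) le_rfl)
    have := (norm_le_pi_norm (X t) k).trans (norm_le_euclNorm (X t))
    rw [Real.norm_eq_abs] at this
    linarith

end IsIndepInput

/-! ### The plug-in emulator -/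

lemma derivEstimator_mul_eq {d L : ℕ} (M : (Fin d → ℝ) → ℝ) (β : Fin L → ℝ) (C : ℕ → Fin L → ℝ)
    (σ : ℝ) (h : Fin d → ℝ) (V : ℕ → Fin d → ℝ) (N : ℕ) (v : Finset (Fin d)) (y : Fin d → ℝ)
    (W : ℝ) : derivEstimator M β C σ h V N v y * W = 1 / (N : ℝ) * ∑ i ∈ Finset.range N,
      ((∑ l, C v.card l * M (fun k => y k + β l * h k * V i k)) * W) *
        ∏ k ∈ v, V i k / (h k * σ ^ 2) := by
  rw [derivEstimator, mul_assoc, Finset.sum_mul]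
  congr 1
  refine Finset.sum_congr rfl fun i _ => ?_
  rw [← Finset.sum_mul]
  ring

lemma integral_derivEstimator_mul {d n L : ℕ} {ν : Fin d → Measure ℝ}
    [∀ k, IsProbabilityMeasure (ν k)] {w : Fin d → ℝ → ℝ} {x : Fin d → ℝ}
    (hw : ∀ k, IsExpansionWeight n (ν k) (w k) (x k)) {M : (Fin d → ℝ) → ℝ} (hM : Continuous M)
    {β : Fin L → ℝ} {C : ℕ → Fin L → ℝ} {v : Finset (Fin d)} {r : ℕ} {K : ℝ} (hK : 0 ≤ K)
    (hS : StencilBound M β (C v.card) n r K) (σ : ℝ) (h : Fin d → ℝ) (V : ℕ → Fin d → ℝ) (N : ℕ) :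
    Integrable (fun y => derivEstimator M β C σ h V N v y * ∏ k ∈ v, w k (y k)) (Measure.pi ν) ∧
    ∫ y, derivEstimator M β C σ h V N v y * ∏ k ∈ v, w k (y k) ∂Measure.pi ν =
      1 / (N : ℝ) * ∑ i ∈ Finset.range N, sampleTerm ν w M β (C v.card) σ h v (V i) := by
  simp_rw [derivEstimator_mul_eq]
  have hi := fun i => (hS.integrable hw hM hK h (V i) v).mul_const
    (∏ k ∈ v, V i k / (h k * σ ^ 2))
  refine ⟨(integrable_finsetSum _ fun i _ => hi i).const_mul _, ?_⟩
  rw [integral_const_mul, integral_finsetSum _ fun i _ => hi i]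
  simp_rw [integral_mul_const]
  rfl

lemma measurable_derivEstimator {d L : ℕ} {M : (Fin d → ℝ) → ℝ} (hM : Continuous M)
    (β : Fin L → ℝ) (C : ℕ → Fin L → ℝ) (σ : ℝ) (h : Fin d → ℝ) (V : ℕ → Fin d → ℝ) (N : ℕ)
    (v : Finset (Fin d)) : Measurable (derivEstimator M β C σ h V N v) := by
  unfold derivEstimator
  exact Continuous.measurable (by fun_prop)

lemma CoeffConstraints.sum_eq_zero {d L : ℕ} {β : Fin L → ℝ} {C : ℕ → Fin L → ℝ}
    (hC : CoeffConstraints d β C) {v : Finset (Fin d)} (hv : v.Nonempty) {q : ℕ}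
    (hq : q ≤ rStar v.card) : ∑ l, C v.card l * β l ^ q = 0 := by
  have hp := hv.card_pos
  rw [hC v.card hp (by simpa using v.card_le_univ) q (Or.inl hq), if_neg]
  have : rStar v.card ≤ v.card - 1 := min_le_left _ _
  omega

lemma CoeffConstraints.sum_eq_one {d L : ℕ} {β : Fin L → ℝ} {C : ℕ → Fin L → ℝ}
    (hC : CoeffConstraints d β C) {v : Finset (Fin d)} (hv : v.Nonempty) :
    ∑ l, C v.card l * β l ^ v.card = 1 := by
  rw [hC v.card hv.card_pos (by simpa using v.card_le_univ) _ (Or.inr rfl), if_pos rfl]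

lemma CoeffConstraints.exists_stencilBound {d L : ℕ} {β : Fin L → ℝ} {C : ℕ → Fin L → ℝ}
    (hC : CoeffConstraints d β C) {M : (Fin d → ℝ) → ℝ} (hM : M ∈ HolderClass d (d + 1))
    {v : Finset (Fin d)} (hv : v.Nonempty) :
    ∃ K, 0 ≤ K ∧ StencilBound M β (C v.card) d (rStar v.card) K := by
  refine exists_abs_sum_mul_le hM β (C v.card) ?_ fun q hq => hC.sum_eq_zero hv hq
  have h1 : rStar v.card ≤ v.card - 1 := min_le_left _ _
  have h2 : v.card ≤ d := by simpa using v.card_le_univ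
  omega

theorem corollary4 {d : ℕ} (hd : 1 ≤ d)
    (M : (Fin d → ℝ) → ℝ) (hM : M ∈ HolderClass d (d + 1))
    (β : Fin 5 → ℝ) (C : ℕ → Fin 5 → ℝ) (hC : CoeffConstraints d β C)
    {S : Type*} [MeasurableSpace S] (P : Measure S) [IsProbabilityMeasure P]
    (V : ℕ → S → Fin d → ℝ) (σ : ℝ) (hσ : 0 < σ) (hV : IsPerturbationSample P V σ)
    (Ω : Set (Fin d → ℝ)) (hΩ : IsOpen Ω) (hΩc : IsConnected Ω)
    {T : Type*} [MeasurableSpace T] (Q : Measure T) [IsProbabilityMeasure Q]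
    (X : T → Fin d → ℝ) (g : Fin d → ℝ → ℝ) (hX : IsIndepInput Q X g Ω)
    (hXint : Integrable (fun t => euclNorm (X t) ^ (d + 1)) Q)
    (h : ℕ → Fin d → ℝ) (hpos : ∀ N k, 0 < h N k)
    (hA2 : ∀ N, BandwidthBound P (V 0) σ β (h N))
    (hlim : Tendsto h atTop (𝓝 0))
    (hvar : ∀ u : Finset (Fin d), u.Nonempty →
      Tendsto (fun N : ℕ =>
          euclNorm (h N) ^ (2 * (rStar u.card + 1)) / ((N : ℝ) * ∏ k ∈ u, h N k ^ 2))
        atTop (𝓝 0))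
    (x : Fin d → ℝ) (hx : x ∈ Ω) :
    Integrable (fun t => M (X t)) Q ∧
    (∀ (N : ℕ) (s : S) (v : Finset (Fin d)), v.Nonempty →
      Integrable (fun t => derivEstimator M β C σ (h N) (fun i => V i s) N v (X t) *
        anovaWeight (inputCDF Q X) g x v (X t)) Q) ∧
    TendstoInMeasure P
      (fun (N : ℕ) (s : S) => emulator Q X g M β C σ (h N) (fun i => V i s) N x)
      atTop (fun _ => M x) := by
  obtain ⟨Φ, hΦ, rfl, K, hK, h0, h1⟩ := exists_isMixedDerivFamily hM
  set ν : Fin d → Measure ℝ := fun k => Q.map fun t => X t k with hν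
  set μ : Fin d → Measure ℝ := fun k => P.map fun s => V 0 s k with hμdef
  have : ∀ k, IsProbabilityMeasure (ν k) := fun k =>
    Measure.isProbabilityMeasure_map (hX.measurable k).aemeasurable
  have : ∀ k, IsProbabilityMeasure (μ k) := fun k =>
    Measure.isProbabilityMeasure_map (hV.measurable 0 k).aemeasurable
  set w : Fin d → ℝ → ℝ :=
    fun k a => (inputCDF Q X k a - Set.indicator (Set.Ici (x k)) 1 a) / g k a with hwdef
  have hw : ∀ k, IsExpansionWeight d (ν k) (w k) (x k) := fun k =>
    hX.isExpansionWeight hΩc.isPreconnected hx hXint k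
  have hμ : ∀ k m, Integrable (fun a => (1 + |a|) ^ m) (μ k) := hV.integrable_one_add_abs_pow
  have hmean : ∀ k, ∫ a, a ∂μ k = 0 := fun k => by
    rw [← hV.mean k, hμdef, integral_map (hV.measurable 0 k).aemeasurable (by fun_prop)]
  have hsecond : ∀ k, ∫ a, a ^ 2 ∂μ k = σ ^ 2 := fun k => by
    rw [← hV.variance k, hμdef, integral_map (hV.measurable 0 k).aemeasurable (by fun_prop)]
  have hXp : MeasurePreserving X Q (Measure.pi ν) := ⟨hX.measurable_vector, hX.map_eq_pi⟩
  have hM0 : Continuous (Φ ∅) := hΦ.continuous ∅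
  choose! A hA0 hA using fun (v : Finset (Fin d)) (hv : v.Nonempty) =>
    hC.exists_stencilBound hM hv
  have hest := fun (v : Finset (Fin d)) (hv : v.Nonempty) (N : ℕ) (s : S) =>
    integral_derivEstimator_mul hw hM0 (hA0 v hv) (hA v hv) σ (h N) (fun i => V i s) N
  have hMint : Integrable (Φ ∅) (Measure.pi ν) := by
    simpa using integrable_partial_expansion hw hΦ hK h0 h1 ∅ ∅
  refine ⟨hXp.integrable_comp_of_integrable hMint, fun N s v hv =>
    hXp.integrable_comp_of_integrable (hest v hv N s).1, ?_⟩
  have hwm : ∀ k, Measurable (w k) := fun k => (hw k).measurable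
  set F : Finset (Finset (Fin d)) := Finset.univ.filter fun v => 0 < v.card with hF
  have hFne : ∀ v ∈ F, v.Nonempty := fun v hv => Finset.card_pos.1 (Finset.mem_filter.1 hv).2
  -- All terms v are gathered into one function of the perturbation, so that the weak law is applied
  -- once.
  set ψ : ℕ → (Fin d → ℝ) → ℝ := fun N z =>
    ∑ v ∈ F, sampleTerm ν w (Φ ∅) β (C v.card) σ (h N) v z with hψ
  have htm : ∀ N v, Measurable (sampleTerm ν w (Φ ∅) β (C v.card) σ (h N) v) := fun N v =>
    measurable_sampleTerm hwm hM0 (h N) v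
  have htL : ∀ N, ∀ v ∈ F, MemLp (sampleTerm ν w (Φ ∅) β (C v.card) σ (h N) v) 2 (Measure.pi μ) :=
    fun N v hv => memLp_sampleTerm hw hM0 (hA0 v (hFne v hv)) (hA v (hFne v hv)) hμ (hpos N) v
  have hemul : ∀ N s, emulator Q X g (Φ ∅) β C σ (h N) (fun i => V i s) N x =
      ∫ y, Φ ∅ y ∂Measure.pi ν + 1 / (N : ℝ) * ∑ i ∈ Finset.range N, ψ N (V i s) := by
    intro N s
    have hchange : ∀ f : (Fin d → ℝ) → ℝ, Measurable f →
        ∫ t, f (X t) ∂Q = ∫ y, f y ∂Measure.pi ν := fun f hf => by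
      rw [← hXp.map_eq, integral_map hXp.measurable.aemeasurable hf.aestronglyMeasurable]
    rw [emulator, hchange _ hM0.measurable]
    congr 1
    simp only [hψ]
    rw [Finset.sum_comm, Finset.mul_sum]
    refine Finset.sum_congr rfl fun v hv => ?_
    rw [← (hest v (hFne v hv) N s).2]
    exact hchange (fun y => derivEstimator (Φ ∅) β C σ (h N) (fun i => V i s) N v y *
      ∏ k ∈ v, w k (y k)) ((measurable_derivEstimator hM0 _ _ _ _ _ _ _).mul (by fun_prop))
  have hanova : Φ ∅ x = ∫ y, Φ ∅ y ∂Measure.pi ν +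
      ∑ v ∈ F, ∫ y, Φ v y * ∏ k ∈ v, w k (y k) ∂Measure.pi ν := by
    have hFe : F = Finset.univ.erase ∅ := by
      ext v; simp [hF, Finset.card_pos, Finset.nonempty_iff_ne_empty]
    rw [anova_expansion hw hΦ hK h0 h1, hFe,
      ← Finset.add_sum_erase Finset.univ _ (Finset.mem_univ ∅)]
    simp
  have hψmean : Tendsto (fun N => ∫ z, ψ N z ∂Measure.pi μ) atTop
      (𝓝 (∑ v ∈ F, ∫ y, Φ v y * ∏ k ∈ v, w k (y k) ∂Measure.pi ν)) := by
    have hsplit : ∀ N, ∫ z, ψ N z ∂Measure.pi μ =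
        ∑ v ∈ F, ∫ z, sampleTerm ν w (Φ ∅) β (C v.card) σ (h N) v z ∂Measure.pi μ := fun N =>
      integral_finsetSum _ fun v hv => (htL N v hv).integrable one_le_two
    simp_rw [hsplit]
    exact tendsto_finsetSum F fun v hv => tendsto_integral_sampleTerm hw hΦ hK h0
      (h1 v (hFne v hv)) (hA0 v (hFne v hv)) (hA v (hFne v hv)) hμ hσ.ne' hmean hsecond
      (hC.sum_eq_one (hFne v hv)) hpos hlim
  have hψsq : Tendsto (fun N : ℕ => (∫ z, ψ N z ^ 2 ∂Measure.pi μ) / (N : ℝ)) atTop (𝓝 0) := by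
    choose! B hB0 hB using fun (v : Finset (Fin d)) (hv : v.Nonempty) =>
      integral_sampleTerm_sq_le (σ := σ) (μ := μ) hw (hA0 v hv) (hA v hv) hμ v
    have hnorm : Tendsto (fun N => ‖h N‖) atTop (𝓝 0) := by simpa using hlim.norm
    have hbound : Tendsto (fun N : ℕ => (F.card : ℝ) * ∑ v ∈ F, B v *
        (euclNorm (h N) ^ (2 * (rStar v.card + 1)) / ((N : ℝ) * ∏ k ∈ v, h N k ^ 2)))
        atTop (𝓝 0) := by
      have := (tendsto_finsetSum F fun v hv => (hvar v (hFne v hv)).const_mul (B v)).const_mul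
        (F.card : ℝ)
      simpa using this
    refine squeeze_zero' (Eventually.of_forall fun N =>
      div_nonneg (integral_nonneg fun z => sq_nonneg _) (Nat.cast_nonneg N)) ?_ hbound
    -- The second-moment bound holds for ‖h‖ ≤ 1. Cauchy–Schwarz over the finitely many v then
    -- reduces the square of the sum to the separate second moments.
    filter_upwards [hnorm.eventually (eventually_le_nhds zero_lt_one)] with N hN
    have hsq : ∫ z, ψ N z ^ 2 ∂Measure.pi μ ≤ F.card * ∑ v ∈ F,
        ∫ z, sampleTerm ν w (Φ ∅) β (C v.card) σ (h N) v z ^ 2 ∂Measure.pi μ := by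
      rw [← integral_finsetSum _ fun v hv => (htL N v hv).integrable_sq, ← integral_const_mul]
      refine integral_mono_of_nonneg (Eventually.of_forall fun z => sq_nonneg _)
        ((integrable_finsetSum _ fun v hv => (htL N v hv).integrable_sq).const_mul _)
        (Eventually.of_forall fun z => ?_)
      exact sq_sum_le_card_mul_sum_sq
    rw [Finset.mul_sum]
    refine (div_le_div_of_nonneg_right hsq (Nat.cast_nonneg N)).trans ?_
    rw [Finset.mul_sum, Finset.sum_div]
    refine Finset.sum_le_sum fun v hv => ?_
    rw [mul_div_assoc]
    refine mul_le_mul_of_nonneg_left ?_ (Nat.cast_nonneg _)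
    have hp : 0 < ∏ k ∈ v, h N k ^ 2 := Finset.prod_pos fun k _ => pow_pos (hpos N k) 2
    calc _ ≤ B v * (‖h N‖ ^ (2 * (rStar v.card + 1)) / ∏ k ∈ v, h N k ^ 2) / N := by
          gcongr
          exact hB v (hFne v hv) (h N) (hpos N) hN
      _ ≤ B v * (euclNorm (h N) ^ (2 * (rStar v.card + 1)) / ∏ k ∈ v, h N k ^ 2) / N := by
          have := hB0 v (hFne v hv)
          gcongr
          exact norm_le_euclNorm _
      _ = _ := by rw [mul_div_assoc, div_div, mul_comm (N : ℝ)]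
  have hlaw := tendstoInMeasure_average hV.measurable_vector hV.map_eq_pi hV.indepFun
    (fun N => Finset.measurable_fun_sum _ fun v _ => htm N v)
    (fun N => memLp_finsetSum _ (htL N)) hψmean hψsq
  intro ε hε
  refine (hlaw ε hε).congr fun N => ?_
  -- Emulator and target share the summand E[M(X)], which drops out of the distance.
  simp only [hemul, hanova]
  simp only [edist_add_left]
  rfl
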